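/- **Setting.** Let $f:\mathbb R^2\to\mathbb R$ be differentiable and $c$-strongly convex for some $c>0$, meaning $f(y)\ge f(x)+\nabla f(x)^{\intercal}(y-x)+c\|y-x\|_2^2$ for all $x,y\in\mathbb R^2$. Consider $(\mathrm{CM})$: $\min\{f(z):z\in\mathbb Z^2\}$. For finite non-empty $S\subseteq\mathbb Z^2$ put $\operatorname{GP}(S)=\{x\in\mathbb R^2:\nabla f(w)^{\intercal}(x-w)\le 0\ \forall w\in S\}$ and let $\operatorname{intr}\operatorname{GP}(S)$ be given by the strict inequalities; $\operatorname{GP}(S)$ is *lattice-free* if $\operatorname{intr}\operatorname{GP}(S)\cap\mathbb Z^2=\emptyset$. Say that $y$ *strictly cuts* $x$ if $\nabla f(y)^{\intercal}(x-y)>0$. A *unimodular set* is $\mathcal U=\mathcal U(z,U)=\{z+Ue:e\in\{0,1\}^2\}$ with $z\in\mathbb Z^2$, $U=(u^1,u^2)\in\mathbb Z^{2\times2}$, $|\det U|=1$. Put $r_{\mathcal U}(x)=\min\{\|U^{-1}(x-w)\|_1:w\in\mathcal U\}$ and $A(\mathcal U)=\mathcal U\cap\operatorname{GP}(\mathcal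 U)$. The labelled set $\mathcal U(z,U)$ is *preprocessed* if (i) $z\in\operatorname{GP}(\mathcal U)$; (ii) if $|A(\mathcal U)|=2$, then either $A(\mathcal U)=\{z,z+u^1\}$, or $A(\mathcal U)=\{z,z+u^1+u^2\}$, $z$ strictly cuts $z+u^1$ and $z+u^1+u^2$ strictly cuts $z+u^2$; (iii) if $|A(\mathcal U)|=3$, then $A(\mathcal U)=\{z,z+u^1,z+u^2\}$. A unimodular set is *connected* if for some labelling $\mathcal U(z,U)$ of it $z,z+u^1\in A(\mathcal U)$. For $i\in\{-1,1\}$ let $H^i=\{z+ku^1+iu^2\in\operatorname{intr}\operatorname{GP}(\mathcal U):k\in\mathbb R\}$. **Updates.** For a preprocessed $\mathcal U(z,U)$ define $\textsc{Flip}(U)$ by the following cases. 1. $A(\mathcal U)=\{z\}$: $\textsc{Flip}(U)=(\sigma^1u^1,\sigma^2u^2)$, where $\sigma^i=1$ if $\nabla f(z)^{\intercal}u^i\le0$ and $\sigma^i=-1$ otherwise. 2. $A(\mathcal U)=\{z,z+u^1+u^2\}$: let $U'=(u^1,u^1+u^2)$, $U''=(-u^1,u^1+u^2)$, $\mathcal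 U'=\mathcal U(z,U')$, $\mathcal U''=\mathcal U(z,U'')$. If $\mathcal U'$ is connected, or $A(\mathcal U')=\{z+2u^1+u^2\}$, or ($z+u^1+u^2$ strictly cuts $z-u^1$ and $z-u^1$ strictly cuts $z$), then $\textsc{Flip}(U)=U'$. Else if $\mathcal U''$ is connected, or $A(\mathcal U'')=\{z-u^1\}$, or ($z$ strictly cuts $z+2u^1+u^2$ and $z+2u^1+u^2$ strictly cuts $z+u^1+u^2$), then $\textsc{Flip}(U)=U''$. Else $\textsc{Flip}(U)=(-u^1,2u^1+u^2)$. 3. $A(\mathcal U)=\{z,z+u^1\}$ and $H^i\cap\mathbb Z^2=\{z+ku^1+iu^2\}$ for some $i\in\{-1,1\}$: $\textsc{Flip}(U)=(ku^1+iu^2,-(k-1)u^1-iu^2)$. 4. $A(\mathcal U)=\{z,z+u^1\}$ and $|H^i\cap\mathbb Z^2|\ge2$ for some $i\in\{-1,1\}$: choose $z+ku^1+iu^2\in H^i\cap\mathbb Z^2$ with $|k|$ minimal; $\textsc{Flip}(U)=(u^1,ku^1+iu^2)$ if $k\ge0$ and $\textsc{Flip}(U)=(u^1,(k-1)u^1+iu^2)$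 if $k\le-1$. 5. $A(\mathcal U)=\{z,z+u^1,z+u^2\}$ and $H^i\cap\mathbb Z^2\ne\emptyset$ for some $i\in\{-1,1\}$: $\textsc{Flip}(U)=(u^1,-u^1+u^2)$ if $i=1$ and $\textsc{Flip}(U)=(u^1-u^2,u^2)$ if $i=-1$. If no $v\in\mathcal U$ has $\nabla f(v)=\mathbf 0$ and some case applies, an *update* replaces $\mathcal U$ by the set $\mathcal U(z,\textsc{Flip}(U))$, relabelled so that it is preprocessed; otherwise $\mathcal U$ is not updated any more. Where several choices of $i$ or of the labelling are possible, any of them may be made. **Statement.** Let $z^0\in\mathbb Z^2$, and let $\mathcal U^0$ be the set $\mathcal U(z^0,\mathbb I^2)=\{z^0+e:e\in\{0,1\}^2\}$ with a preprocessed labelling (for example $U^0=\mathbb I^2$ itself, if $\mathcal U(z^0,\mathbb I^2)$ is preprocessed). Let $z^*$ be an optimal solution of $(\mathrm{CM})$, and let $f$ be $L$-Lipschitz, with respect to $\|\cdot\|_2$, on some convex set containing $\mathcal U^0\cup\{z^*\}$. Then a sequence $\mathcal U^0,\mathcal U^1,\dots$ of successive updates (constant once no update is made) exists, and for every such sequence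 there is a $$T_1\le\Big(\frac{6L}{c}+2\Big)\,r_{\mathcal U^0}(z^*)$$ such that the first $T_1$ steps are updates and $\mathcal U^{T_1}$ contains an optimal solution of $(\mathrm{CM})$. The polyhedron $\operatorname{GP}(\mathcal U^{T_1})$ is not necessarily lattice-free: there are $f,L,c,z^0,\mathcal U^0,z^*$ as above, a sequence of updates, and $0<T_1\le(6L/c+2)\,r_{\mathcal U^0}(z^*)$ such that the first $T_1$ steps are updates, $\mathcal U^{T_1}$ is the first set of the sequence that contains an optimal solution, and $\operatorname{GP}(\mathcal U^{T_1})$ is not lattice-free. -/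

import Mathlib

/-- The Euclidean plane `ℝ²`. -/
abbrev Plane : Type := EuclideanSpace ℝ (Fin 2)

/-- The integer lattice `ℤ²`. -/
abbrev Lattice2 : Type := Fin 2 → ℤ

/-- The inclusion `ℤ² ⊆ ℝ²`. -/
noncomputable def emb (z : Lattice2) : Plane := WithLp.toLp 2 (fun i => (z i : ℝ))

/-- `f` is `c`-strongly convex, in the normalisation
`f y ≥ f x + ∇f(x)ᵀ(y - x) + c ‖y - x‖²` (Euclidean norm). -/
def IsStronglyConvex (f : Plane → ℝ) (c : ℝ) : Prop :=
  ∀ x y : Plane, f x + inner ℝ (gradient f x) (y - x) + c * ‖y - x‖ ^ 2 ≤ f y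

/-- `z` is an optimal solution of `min {f(z) : z ∈ ℤ²}`. -/
def IsOptimal (f : Plane → ℝ) (z : Lattice2) : Prop :=
  ∀ w : Lattice2, f (emb z) ≤ f (emb w)

/-- `y` strictly cuts `x`. -/
def StrictlyCuts (f : Plane → ℝ) (y x : Lattice2) : Prop :=
  0 < inner ℝ (gradient f (emb y)) (emb x - emb y)

/-- The gradient polyhedron of a set of lattice vectors. -/
def gradPoly (f : Plane → ℝ) (S : Set Lattice2) : Set Plane :=
  {x | ∀ w ∈ S, inner ℝ (gradient f (emb w)) (x - emb w) ≤ 0}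

/-- The interior of the gradient polyhedron, defined through strict inequalities. -/
def intrGradPoly (f : Plane → ℝ) (S : Set Lattice2) : Set Plane :=
  {x | ∀ w ∈ S, inner ℝ (gradient f (emb w)) (x - emb w) < 0}

/-- The gradient polyhedron of `S` is lattice-free. -/
def LatticeFree (f : Plane → ℝ) (S : Set Lattice2) : Prop :=
  ∀ z : Lattice2, emb z ∉ intrGradPoly f S

/-- The set `S ∩ GP(S)`. -/
def activeSet (f : Plane → ℝ) (S : Set Lattice2) : Set Lattice2 :=
  {w | w ∈ S ∧ emb w ∈ gradPoly f S}

/-- The matrix with columns `p` and `q`. -/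
def ofCols (p q : Lattice2) : Matrix (Fin 2) (Fin 2) ℤ :=
  Matrix.of fun i j => if j = 0 then p i else q i

/-- The set `𝒰(z, U) = {z + U e : e ∈ {0,1}²}`. -/
def latticeCell (z : Lattice2) (U : Matrix (Fin 2) (Fin 2) ℤ) : Set Lattice2 :=
  {w | ∃ e : Lattice2, (∀ i, e i = 0 ∨ e i = 1) ∧ w = z + U.mulVec e}

/-- A unimodular set `𝒰(z, U)` together with its anchor `z` and its matrix `U`. -/
structure UniSet where
  /-- the anchor -/
  z : Lattice2
  /-- the matrix -/
  U : Matrix (Fin 2) (Fin 2) ℤ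
  /-- unimodularity -/
  abs_det : |U.det| = 1

namespace UniSet

/-- The underlying set of four lattice vectors. -/
def carrier (P : UniSet) : Set Lattice2 := latticeCell P.z P.U

/-- The first column of the matrix. -/
def u1 (P : UniSet) : Lattice2 := fun i => P.U i 0

/-- The second column of the matrix. -/
def u2 (P : UniSet) : Lattice2 := fun i => P.U i 1

end UniSet

/-- `r_𝒰(x) = min {‖U⁻¹(x - w)‖₁ : w ∈ 𝒰}`; since `U` is unimodular this is a natural number. -/
noncomputable def rDist (P : UniSet) (x : Lattice2) : ℕ :=
  sInf {n : ℕ | ∃ w ∈ P.carrier, n = ∑ i, ((P.U⁻¹).mulVec (x - w) i).natAbs}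

/-- The preprocessing properties of a labelled unimodular set. -/
def Preprocessed (f : Plane → ℝ) (P : UniSet) : Prop :=
  emb P.z ∈ gradPoly f P.carrier ∧
  ((activeSet f P.carrier).ncard = 2 →
    activeSet f P.carrier = {P.z, P.z + P.u1} ∨
    (activeSet f P.carrier = {P.z, P.z + P.u1 + P.u2} ∧
      StrictlyCuts f P.z (P.z + P.u1) ∧
      StrictlyCuts f (P.z + P.u1 + P.u2) (P.z + P.u2))) ∧
  ((activeSet f P.carrier).ncard = 3 →
    activeSet f P.carrier = {P.z, P.z + P.u1, P.z + P.u2})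

/-- A unimodular set is connected if, for some labelling `𝒰(z, U)` of it, both `z` and `z + u¹`
belong to its gradient polyhedron, i.e. two neighbouring vertices do. For preprocessed sets this
can be read off from the given labelling. -/
def IsConnectedCell (f : Plane → ℝ) (S : Set Lattice2) : Prop :=
  ∃ Q : UniSet, Q.carrier = S ∧ Q.z ∈ activeSet f S ∧ Q.z + Q.u1 ∈ activeSet f S

/-- The lattice vectors in the segment
`Hⁱ = {z + k u¹ + i u² ∈ intr GP(𝒰) : k ∈ ℝ}`. -/
def latticeH (f : Plane → ℝ) (P : UniSet) (i : ℤ) : Set Lattice2 :=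
  {w | emb w ∈ intrGradPoly f P.carrier ∧
    ∃ k : ℝ, emb w = emb P.z + k • emb P.u1 + (i : ℝ) • emb P.u2}

/-- The sign `σ` in the first case: `1` if `∇f(z)ᵀ u ≤ 0` and `-1` otherwise. -/
noncomputable def flipSign (f : Plane → ℝ) (z u : Lattice2) : ℤ :=
  if inner ℝ (gradient f (emb z)) (emb u) ≤ 0 then 1 else -1

/-- The condition under which the second case flips `U` to `U' = (u¹, u¹ + u²)`. -/
def CondA (f : Plane → ℝ) (P : UniSet) : Prop :=
  IsConnectedCell f (latticeCell P.z (ofCols P.u1 (P.u1 + P.u2))) ∨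
  activeSet f (latticeCell P.z (ofCols P.u1 (P.u1 + P.u2))) = {P.z + (2 : ℤ) • P.u1 + P.u2} ∨
  (StrictlyCuts f (P.z + P.u1 + P.u2) (P.z - P.u1) ∧ StrictlyCuts f (P.z - P.u1) P.z)

/-- The condition under which the second case flips `U` to `U'' = (-u¹, u¹ + u²)`, provided that
it does not flip `U` to `U'`. -/
def CondB (f : Plane → ℝ) (P : UniSet) : Prop :=
  IsConnectedCell f (latticeCell P.z (ofCols (-P.u1) (P.u1 + P.u2))) ∨
  activeSet f (latticeCell P.z (ofCols (-P.u1) (P.u1 + P.u2))) = {P.z - P.u1} ∨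
  (StrictlyCuts f P.z (P.z + (2 : ℤ) • P.u1 + P.u2) ∧
    StrictlyCuts f (P.z + (2 : ℤ) • P.u1 + P.u2) (P.z + P.u1 + P.u2))

/-- `FlipTo f P V` means that `V` is an admissible value of `Flip(U)` for `P = 𝒰(z, U)`. It is a
relation because the third and fourth case allow either of `H¹` and `H⁻¹` where both qualify. -/
inductive FlipTo (f : Plane → ℝ) (P : UniSet) : Matrix (Fin 2) (Fin 2) ℤ → Prop
  | case1 (h : activeSet f P.carrier = {P.z}) :
      FlipTo f P (ofCols (flipSign f P.z P.u1 • P.u1) (flipSign f P.z P.u2 • P.u2))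
  | case2a (h : activeSet f P.carrier = {P.z, P.z + P.u1 + P.u2}) (hA : CondA f P) :
      FlipTo f P (ofCols P.u1 (P.u1 + P.u2))
  | case2b (h : activeSet f P.carrier = {P.z, P.z + P.u1 + P.u2}) (hA : ¬ CondA f P)
      (hB : CondB f P) :
      FlipTo f P (ofCols (-P.u1) (P.u1 + P.u2))
  | case2c (h : activeSet f P.carrier = {P.z, P.z + P.u1 + P.u2}) (hA : ¬ CondA f P)
      (hB : ¬ CondB f P) :
      FlipTo f P (ofCols (-P.u1) ((2 : ℤ) • P.u1 + P.u2))
  | case3 (i k : ℤ) (hi : i = -1 ∨ i = 1)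
      (h : activeSet f P.carrier = {P.z, P.z + P.u1})
      (hH : (latticeH f P i).encard = 1)
      (hk : P.z + k • P.u1 + i • P.u2 ∈ latticeH f P i) :
      FlipTo f P (ofCols (k • P.u1 + i • P.u2) (-((k - 1) • P.u1) - i • P.u2))
  | case4pos (i k : ℤ) (hi : i = -1 ∨ i = 1)
      (h : activeSet f P.carrier = {P.z, P.z + P.u1})
      (hH : 2 ≤ (latticeH f P i).encard)
      (hk : P.z + k • P.u1 + i • P.u2 ∈ latticeH f P i)
      (hmin : ∀ l : ℤ, P.z + l • P.u1 + i • P.u2 ∈ latticeH f P i → |k| ≤ |l|)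
      (hsign : 0 ≤ k) :
      FlipTo f P (ofCols P.u1 (k • P.u1 + i • P.u2))
  | case4neg (i k : ℤ) (hi : i = -1 ∨ i = 1)
      (h : activeSet f P.carrier = {P.z, P.z + P.u1})
      (hH : 2 ≤ (latticeH f P i).encard)
      (hk : P.z + k • P.u1 + i • P.u2 ∈ latticeH f P i)
      (hmin : ∀ l : ℤ, P.z + l • P.u1 + i • P.u2 ∈ latticeH f P i → |k| ≤ |l|)
      (hsign : k ≤ -1) :
      FlipTo f P (ofCols P.u1 ((k - 1) • P.u1 + i • P.u2))
  | case5pos (h : activeSet f P.carrier = {P.z, P.z + P.u1, P.z + P.u2})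
      (hH : 1 ≤ (latticeH f P 1).encard) :
      FlipTo f P (ofCols P.u1 (-P.u1 + P.u2))
  | case5neg (h : activeSet f P.carrier = {P.z, P.z + P.u1, P.z + P.u2})
      (hH : 1 ≤ (latticeH f P (-1)).encard) :
      FlipTo f P (ofCols (P.u1 - P.u2) P.u2)

/-- `P` is updated: no vector of it has gradient zero, and it fits into a case of the table. -/
def CanUpdate (f : Plane → ℝ) (P : UniSet) : Prop :=
  (∀ w ∈ P.carrier, gradient f (emb w) ≠ 0) ∧ ∃ V, FlipTo f P V

/-- One update: the matrix is flipped, and the resulting unimodular set is relabelled so that it is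
preprocessed. -/
def Update (f : Plane → ℝ) (P Q : UniSet) : Prop :=
  CanUpdate f P ∧ ∃ V, FlipTo f P V ∧ Q.carrier = latticeCell P.z V ∧ Preprocessed f Q

/-- A sequence `𝒰⁰, 𝒰¹, …` produced by the algorithm from `P₀`; it stays constant once no further
update is made. -/
def IsRun (f : Plane → ℝ) (P₀ : UniSet) (s : ℕ → UniSet) : Prop :=
  s 0 = P₀ ∧ ∀ i, Update f (s i) (s (i + 1)) ∨ (¬ CanUpdate f (s i) ∧ s (i + 1) = s i)

/-- `P` contains an optimal solution. -/
def ContainsOptimal (f : Plane → ℝ) (P : UniSet) : Prop :=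
  ∃ w ∈ P.carrier, IsOptimal f w

/-- The hypotheses of the convergence bound: `f` is differentiable and `c`-strongly convex,
`P₀` is the preprocessed set `{z₀ + e : e ∈ {0,1}²}`, `zs` is an optimal solution, and `f` is
`L`-Lipschitz on a convex set that contains `P₀` and `zs`. -/
structure Setting (f : Plane → ℝ) (L : NNReal) (c : ℝ) (K : Set Plane) (z₀ : Lattice2)
    (P₀ : UniSet) (zs : Lattice2) : Prop where
  differentiable : Differentiable ℝ f
  c_pos : 0 < c
  stronglyConvex : IsStronglyConvex f c
  carrier_eq : P₀.carrier = latticeCell z₀ 1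
  preprocessed : Preprocessed f P₀
  optimal : IsOptimal f zs
  convex : Convex ℝ K
  carrier_mem : ∀ w ∈ P₀.carrier, emb w ∈ K
  optimal_mem : emb zs ∈ K
  lipschitz : LipschitzOnWith L f K

/-! ### The lattice in the plane -/

/-! Every flip keeps all active vertices (`FlipTo.spec`), hence a minimiser `w` of `f` on the
current cell. If `w` is still active afterwards, an integer potential `pot` drops by at least one.
Otherwise a vertex of the new cell cuts `w`; distinct lattice points have distance at least one, so
the minimum of `f` over the cell falls by at least `c`, while `pot` rises by at most five. So `pot +
6 * min f / c` falls by at least one per update (`update_decrease`, `IsRun.potential_bound`). As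
long as the cell contains no optimal solution, the optimum is a lattice point of the interior of the
gradient polyhedron, so some case of the table applies (`exists_flipTo`) and `pot ≥ -1`. Comparing
with the initial cell, where strong convexity and the Lipschitz bound control both terms, gives the
estimate (`Setting.bound`).

Let `(p, q)` be the coordinates of the optimum in the current cell and `rad p q` its sup-distance
from that cell. The potential is `3 * rad` with a correction for the shape of the active set: `-4`
if two adjacent vertices are active, `-3` for two opposite ones, and `-2` for an edge with the
optimum beyond it, at a depth not exceeding its distance along the edge; there a reflection at the
edge need not lower `rad`. With a single active vertex, `rad` is taken in the cell to which the
first case flips.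

Most flips lower `rad` by one, and the danger is a new cell with `w` as its only active vertex. Two
lemmas control this: such a vertex must cut one of its neighbours (`neighbour_cut`), and if it does
not cut one of them, then all interior lattice points lie beyond it, away from the other
(`single_flip_side`). Either this is contradictory, or the optimum is placed so that the next flip
brings it closer still.

For the second claim a squared distance suffices: one update reaches the optimum, while a further
lattice point remains uncut (`NonLatticeFree.exists_run`). -/

lemma emb_add (x y : Lattice2) : emb (x + y) = emb x + emb y := by
  ext i; simp [emb]

lemma emb_sub (x y : Lattice2) : emb (x - y) = emb x - emb y := by
  ext i; simp [emb]

lemma emb_smul (k : ℤ) (x : Lattice2) : emb (k • x) = (k : ℝ) • emb x := by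
  ext i; simp [emb]

lemma norm_emb_sq (x : Lattice2) : ‖emb x‖ ^ 2 = (x 0 : ℝ) ^ 2 + (x 1 : ℝ) ^ 2 := by
  rw [EuclideanSpace.norm_sq_eq]
  simp [emb, Fin.sum_univ_two]

lemma one_le_norm_emb_sub_sq {x y : Lattice2} (h : x ≠ y) : 1 ≤ ‖emb x - emb y‖ ^ 2 := by
  rw [← emb_sub, norm_emb_sq]
  have h' : 1 ≤ (x - y) 0 ^ 2 + (x - y) 1 ^ 2 := by
    by_contra hlt
    have h0 : (x - y) 0 = 0 := by nlinarith [sq_nonneg ((x - y) 0), sq_nonneg ((x - y) 1)]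
    have h1 : (x - y) 1 = 0 := by nlinarith [sq_nonneg ((x - y) 0), sq_nonneg ((x - y) 1)]
    apply h
    funext i
    fin_cases i
    · simpa [sub_eq_zero] using h0
    · simpa [sub_eq_zero] using h1
  exact_mod_cast h'

/-- The value `∇f(w)ᵀ(x - w)`. -/
noncomputable def cutVal (f : Plane → ℝ) (w x : Lattice2) : ℝ :=
  inner ℝ (gradient f (emb w)) (emb x - emb w)

/-- The restriction of `f` to the lattice. -/
noncomputable def latVal (f : Plane → ℝ) (x : Lattice2) : ℝ := f (emb x)

/-- The form of strong convexity that the lattice sees. -/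
def LatticeConvex (f : Plane → ℝ) (c : ℝ) : Prop :=
  0 < c ∧ ∀ w x : Lattice2, w ≠ x → latVal f w + cutVal f w x + c ≤ latVal f x

lemma IsStronglyConvex.latticeConvex {f : Plane → ℝ} {c : ℝ} (hc : 0 < c)
    (h : IsStronglyConvex f c) : LatticeConvex f c := by
  refine ⟨hc, fun w x hwx => ?_⟩
  have h1 := h (emb w) (emb x)
  have h2 := one_le_norm_emb_sub_sq hwx.symm
  unfold latVal cutVal
  nlinarith

lemma cutVal_self (f : Plane → ℝ) (w : Lattice2) : cutVal f w w = 0 := by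
  simp [cutVal]

namespace LatticeConvex

variable {f : Plane → ℝ} {c : ℝ}

lemma drop (h : LatticeConvex f c) {w x : Lattice2} (hc : 0 < cutVal f w x) :
    latVal f w + c ≤ latVal f x := by
  have hne : w ≠ x := by
    rintro rfl
    simp [cutVal_self] at hc
  linarith [h.2 w x hne]

lemma cutVal_nonpos (h : LatticeConvex f c) {w x : Lattice2} (hv : latVal f x ≤ latVal f w) :
    cutVal f w x ≤ 0 := by
  by_contra hlt
  linarith [h.drop (not_le.mp hlt), h.1]

lemma cutVal_neg (h : LatticeConvex f c) {w x : Lattice2} (hne : w ≠ x)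
    (hv : latVal f x ≤ latVal f w) : cutVal f w x < 0 := by
  linarith [h.2 w x hne, h.1]

lemma not_both (h : LatticeConvex f c) {w x : Lattice2} (h1 : 0 < cutVal f w x) :
    cutVal f x w ≤ 0 :=
  h.cutVal_nonpos (by linarith [h.drop h1, h.1])

end LatticeConvex

/-! ### Coordinates with respect to a unimodular set -/

namespace UniSet

/-- The lattice vector with coordinates `(i, j)`. -/
def pt (P : UniSet) (i j : ℤ) : Lattice2 := P.z + i • P.u1 + j • P.u2

/-- The derivative at `pt i j` in the direction of the first column. -/
noncomputable def gA (f : Plane → ℝ) (P : UniSet) (i j : ℤ) : ℝ :=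
  inner ℝ (gradient f (emb (P.pt i j))) (emb P.u1)

/-- The derivative at `pt i j` in the direction of the second column. -/
noncomputable def gB (f : Plane → ℝ) (P : UniSet) (i j : ℤ) : ℝ :=
  inner ℝ (gradient f (emb (P.pt i j))) (emb P.u2)

lemma cutVal_pt (f : Plane → ℝ) (P : UniSet) (i j x y : ℤ) :
    cutVal f (P.pt i j) (P.pt x y) = (x - i) * P.gA f i j + (y - j) * P.gB f i j := by
  have : emb (P.pt x y) - emb (P.pt i j)
      = ((x : ℝ) - i) • emb P.u1 + ((y : ℝ) - j) • emb P.u2 := by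
    simp only [pt, emb_add, emb_smul]
    module
  rw [cutVal, this, inner_add_right, inner_smul_right, inner_smul_right]
  rfl

lemma det_cases (P : UniSet) :
    P.u1 0 * P.u2 1 - P.u2 0 * P.u1 1 = 1 ∨ P.u1 0 * P.u2 1 - P.u2 0 * P.u1 1 = -1 := by
  have h := P.abs_det
  rw [Matrix.det_fin_two] at h
  have : P.u1 0 * P.u2 1 - P.u2 0 * P.u1 1 = P.U 0 0 * P.U 1 1 - P.U 0 1 * P.U 1 0 := by
    simp [u1, u2]
  rw [this]
  exact eq_or_eq_neg_of_abs_eq h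

lemma pt_apply (P : UniSet) (i j : ℤ) (k : Fin 2) :
    P.pt i j k = P.z k + i * P.u1 k + j * P.u2 k := by
  simp [pt]

lemma pt_inj (P : UniSet) {i j k l : ℤ} : P.pt i j = P.pt k l ↔ i = k ∧ j = l := by
  refine ⟨fun h => ?_, by rintro ⟨rfl, rfl⟩; rfl⟩
  have h0 := congrFun h 0
  have h1 := congrFun h 1
  simp only [pt_apply] at h0 h1
  have hx : (i - k) * (P.u1 0 * P.u2 1 - P.u2 0 * P.u1 1) = 0 := by
    linear_combination P.u2 1 * h0 - P.u2 0 * h1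
  have hy : (j - l) * (P.u1 0 * P.u2 1 - P.u2 0 * P.u1 1) = 0 := by
    linear_combination P.u1 0 * h1 - P.u1 1 * h0
  rcases P.det_cases with h | h <;> rw [h] at hx hy <;> constructor <;> linarith

lemma exists_pt (P : UniSet) (x : Lattice2) : ∃ p q : ℤ, P.pt p q = x := by
  set δ := P.u1 0 * P.u2 1 - P.u2 0 * P.u1 1 with hδ
  have hδ2 : δ * δ = 1 := by rcases P.det_cases with h | h <;> rw [← hδ] at h <;> rw [h] <;> norm_num
  -- Cramer's rule, where the determinant `δ = ±1` is its own inverse.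
  refine ⟨δ * (P.u2 1 * (x 0 - P.z 0) - P.u2 0 * (x 1 - P.z 1)),
    δ * (P.u1 0 * (x 1 - P.z 1) - P.u1 1 * (x 0 - P.z 0)), ?_⟩
  funext k
  rw [pt_apply]
  fin_cases k
  · show P.z 0 + _ * P.u1 0 + _ * P.u2 0 = x 0
    linear_combination (x 0 - P.z 0) * hδ2 + δ * (P.z 0 - x 0) * hδ
  · show P.z 1 + _ * P.u1 1 + _ * P.u2 1 = x 1
    linear_combination (x 1 - P.z 1) * hδ2 + δ * (P.z 1 - x 1) * hδ

lemma mulVec_eq (P : UniSet) (e : Lattice2) : P.U.mulVec e = e 0 • P.u1 + e 1 • P.u2 := by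
  funext i
  simp [Matrix.mulVec, dotProduct, Fin.sum_univ_two, u1, u2, mul_comm]

lemma mem_carrier (P : UniSet) {w : Lattice2} :
    w ∈ P.carrier ↔ w = P.pt 0 0 ∨ w = P.pt 1 0 ∨ w = P.pt 0 1 ∨ w = P.pt 1 1 := by
  constructor
  · rintro ⟨e, he, rfl⟩
    rw [mulVec_eq]
    rcases he 0 with h0 | h0 <;> rcases he 1 with h1 | h1 <;> simp [h0, h1, pt, add_assoc]
  · have key : ∀ i j : ℤ, (i = 0 ∨ i = 1) → (j = 0 ∨ j = 1) → P.pt i j ∈ P.carrier := by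
      intro i j hi hj
      refine ⟨![i, j], ?_, ?_⟩
      · intro k; fin_cases k <;> simpa
      · rw [mulVec_eq]; simp [pt, add_assoc]
    rintro (rfl | rfl | rfl | rfl) <;> apply key <;> simp

lemma pt_mem_carrier (P : UniSet) {i j : ℤ} :
    P.pt i j ∈ P.carrier ↔ (i = 0 ∨ i = 1) ∧ (j = 0 ∨ j = 1) := by
  rw [mem_carrier]
  simp only [pt_inj]
  omega

/-- The unimodular set with anchor `pt i j` and columns `a u¹ + b u²`, `k u¹ + l u²`. -/
def sub (P : UniSet) (i j a b k l : ℤ) (h : |a * l - k * b| = 1) : UniSet where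
  z := P.pt i j
  U := ofCols (a • P.u1 + b • P.u2) (k • P.u1 + l • P.u2)
  abs_det := by
    have h1 := P.abs_det
    rw [Matrix.det_fin_two] at h1 ⊢
    have : (ofCols (a • P.u1 + b • P.u2) (k • P.u1 + l • P.u2)) 0 0 *
        (ofCols (a • P.u1 + b • P.u2) (k • P.u1 + l • P.u2)) 1 1 -
        (ofCols (a • P.u1 + b • P.u2) (k • P.u1 + l • P.u2)) 0 1 *
        (ofCols (a • P.u1 + b • P.u2) (k • P.u1 + l • P.u2)) 1 0
        = (a * l - k * b) * (P.U 0 0 * P.U 1 1 - P.U 0 1 * P.U 1 0) := by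
      simp [ofCols, u1, u2]; ring
    rw [this, abs_mul, h, h1]; rfl

lemma sub_pt (P : UniSet) (i j a b k l : ℤ) (h : |a * l - k * b| = 1) (x y : ℤ) :
    (P.sub i j a b k l h).pt x y = P.pt (i + x * a + y * k) (j + x * b + y * l) := by
  have h1 : (P.sub i j a b k l h).u1 = a • P.u1 + b • P.u2 := by
    funext t; simp [sub, u1, ofCols]
  have h2 : (P.sub i j a b k l h).u2 = k • P.u1 + l • P.u2 := by
    funext t; simp [sub, u2, ofCols]
  unfold pt
  rw [h1, h2]
  show P.z + i • P.u1 + j • P.u2 + _ + _ = _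
  module

lemma gA_sub (f : Plane → ℝ) (P : UniSet) (i j a b k l : ℤ) (h : |a * l - k * b| = 1) (x y : ℤ) :
    (P.sub i j a b k l h).gA f x y =
      a * P.gA f (i + x * a + y * k) (j + x * b + y * l) +
      b * P.gB f (i + x * a + y * k) (j + x * b + y * l) := by
  have h1 : (P.sub i j a b k l h).u1 = a • P.u1 + b • P.u2 := by
    funext t; simp [sub, u1, ofCols]
  rw [gA, sub_pt, h1, emb_add, emb_smul, emb_smul, inner_add_right, inner_smul_right,
    inner_smul_right]
  rfl

lemma gB_sub (f : Plane → ℝ) (P : UniSet) (i j a b k l : ℤ) (h : |a * l - k * b| = 1) (x y : ℤ) :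
    (P.sub i j a b k l h).gB f x y =
      k * P.gA f (i + x * a + y * k) (j + x * b + y * l) +
      l * P.gB f (i + x * a + y * k) (j + x * b + y * l) := by
  have h1 : (P.sub i j a b k l h).u2 = k • P.u1 + l • P.u2 := by
    funext t; simp [sub, u2, ofCols]
  rw [gB, sub_pt, h1, emb_add, emb_smul, emb_smul, inner_add_right, inner_smul_right,
    inner_smul_right]
  rfl

lemma carrier_sub (P : UniSet) (i j a b k l : ℤ) (h : |a * l - k * b| = 1) {w : Lattice2} :
    w ∈ (P.sub i j a b k l h).carrier ↔ w = P.pt i j ∨ w = P.pt (i + a) (j + b) ∨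
      w = P.pt (i + k) (j + l) ∨ w = P.pt (i + a + k) (j + b + l) := by
  simp [mem_carrier, sub_pt]

/-- Two labellings of the same set differ by the choice of the anchor and the order of columns. -/
lemma relabel (P Q : UniSet) (h : Q.carrier = P.carrier) :
    ∃ i j : ℤ, (i = 0 ∨ i = 1) ∧ (j = 0 ∨ j = 1) ∧
      ((∀ x y, Q.pt x y = P.pt (i + (1 - 2 * i) * x) (j + (1 - 2 * j) * y)) ∨
        ∀ x y, Q.pt x y = P.pt (i + (1 - 2 * i) * y) (j + (1 - 2 * j) * x)) := by
  obtain ⟨i, j, hz⟩ := P.exists_pt (Q.pt 0 0)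
  obtain ⟨i1, j1, h1⟩ := P.exists_pt (Q.pt 1 0)
  obtain ⟨i2, j2, h2⟩ := P.exists_pt (Q.pt 0 1)
  have hgen : ∀ x y, Q.pt x y = P.pt (i + x * (i1 - i) + y * (i2 - i))
      (j + x * (j1 - j) + y * (j2 - j)) := by
    intro x y
    funext k
    have hz' := congrFun hz k
    have h1' := congrFun h1 k
    have h2' := congrFun h2 k
    simp only [pt_apply] at *
    linear_combination (-1 + x + y) * hz' - x * h1' - y * h2'
  have m00 : P.pt i j ∈ P.carrier := by rw [hz, ← h, pt_mem_carrier]; simp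
  have m10 : P.pt i1 j1 ∈ P.carrier := by rw [h1, ← h, pt_mem_carrier]; simp
  have m01 : P.pt i2 j2 ∈ P.carrier := by rw [h2, ← h, pt_mem_carrier]; simp
  -- That the fourth image is a vertex too rules out a diagonal of the cell as a column.
  have m11 : P.pt (i + 1 * (i1 - i) + 1 * (i2 - i)) (j + 1 * (j1 - j) + 1 * (j2 - j))
      ∈ P.carrier := by
    rw [← hgen, ← h, pt_mem_carrier]; simp
  rw [pt_mem_carrier] at m00 m10 m01 m11
  have n1 : ¬ (i = i1 ∧ j = j1) := by
    rw [← P.pt_inj, hz, h1, pt_inj]; simp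
  have n2 : ¬ (i = i2 ∧ j = j2) := by
    rw [← P.pt_inj, hz, h2, pt_inj]; simp
  have n3 : ¬ (i1 = i2 ∧ j1 = j2) := by
    rw [← P.pt_inj, h1, h2, pt_inj]; simp
  refine ⟨i, j, m00.1, m00.2, ?_⟩
  have hcase : (i1 - i = 1 - 2 * i ∧ i2 - i = 0 ∧ j1 - j = 0 ∧ j2 - j = 1 - 2 * j) ∨
      (i1 - i = 0 ∧ i2 - i = 1 - 2 * i ∧ j1 - j = 1 - 2 * j ∧ j2 - j = 0) := by
    obtain ⟨hi1, hj1⟩ := m10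
    obtain ⟨hi2, hj2⟩ := m01
    clear hgen hz h1 h2
    rcases m00 with ⟨rfl | rfl, rfl | rfl⟩ <;> rcases hi1 with rfl | rfl <;>
      rcases hj1 with rfl | rfl <;> rcases hi2 with rfl | rfl <;>
      rcases hj2 with rfl | rfl <;> simp_all
  rcases hcase with ⟨e1, e2, e3, e4⟩ | ⟨e1, e2, e3, e4⟩
  · left; intro x y; rw [hgen, e1, e2, e3, e4]; congr 1 <;> ring
  · right; intro x y; rw [hgen, e1, e2, e3, e4]; congr 1 <;> ring

end UniSet

/-! ### Active vertices and interior lattice points -/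

section Active

variable {f : Plane → ℝ} {c : ℝ} {P Q : UniSet}

lemma mem_activeSet {S : Set Lattice2} {w : Lattice2} :
    w ∈ activeSet f S ↔ w ∈ S ∧ ∀ v ∈ S, cutVal f v w ≤ 0 := Iff.rfl

lemma exists_cut {S : Set Lattice2} {w : Lattice2} (hw : w ∈ S) (h : w ∉ activeSet f S) :
    ∃ v ∈ S, 0 < cutVal f v w := by
  rw [mem_activeSet] at h
  push Not at h
  exact h hw

/-- `pt x y` is a lattice point of the interior of the gradient polyhedron. -/
def InIntr (f : Plane → ℝ) (P : UniSet) (x y : ℤ) : Prop :=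
  ∀ v ∈ P.carrier, cutVal f v (P.pt x y) < 0

lemma forall_carrier {p : Lattice2 → Prop} :
    (∀ v ∈ P.carrier, p v) ↔ p (P.pt 0 0) ∧ p (P.pt 1 0) ∧ p (P.pt 0 1) ∧ p (P.pt 1 1) := by
  simp [P.mem_carrier]

lemma exists_carrier {p : Lattice2 → Prop} :
    (∃ v ∈ P.carrier, p v) ↔ p (P.pt 0 0) ∨ p (P.pt 1 0) ∨ p (P.pt 0 1) ∨ p (P.pt 1 1) := by
  simp [P.mem_carrier]

lemma inIntr_iff {x y : ℤ} : InIntr f P x y ↔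
    x * P.gA f 0 0 + y * P.gB f 0 0 < 0 ∧ (x - 1) * P.gA f 1 0 + y * P.gB f 1 0 < 0 ∧
    x * P.gA f 0 1 + (y - 1) * P.gB f 0 1 < 0 ∧
    (x - 1) * P.gA f 1 1 + (y - 1) * P.gB f 1 1 < 0 := by
  rw [InIntr, forall_carrier]
  simp [UniSet.cutVal_pt]

lemma active00 : P.pt 0 0 ∈ activeSet f P.carrier ↔
    0 ≤ P.gA f 1 0 ∧ 0 ≤ P.gB f 0 1 ∧ 0 ≤ P.gA f 1 1 + P.gB f 1 1 := by
  rw [mem_activeSet, forall_carrier]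
  simp only [UniSet.cutVal_pt, UniSet.pt_mem_carrier]
  constructor
  · rintro ⟨-, h1, h2, h3, h4⟩
    norm_num at *
    exact ⟨by linarith, by linarith, by linarith⟩
  · rintro ⟨h1, h2, h3⟩
    norm_num
    exact ⟨by linarith, by linarith, by linarith⟩

lemma active10 : P.pt 1 0 ∈ activeSet f P.carrier ↔
    P.gA f 0 0 ≤ 0 ∧ P.gA f 0 1 ≤ P.gB f 0 1 ∧ 0 ≤ P.gB f 1 1 := by
  rw [mem_activeSet, forall_carrier]
  simp only [UniSet.cutVal_pt, UniSet.pt_mem_carrier]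
  constructor
  · rintro ⟨-, h1, h2, h3, h4⟩
    norm_num at *
    exact ⟨by linarith, by linarith, by linarith⟩
  · rintro ⟨h1, h2, h3⟩
    norm_num
    exact ⟨by linarith, by linarith, by linarith⟩

lemma active01 : P.pt 0 1 ∈ activeSet f P.carrier ↔
    P.gB f 0 0 ≤ 0 ∧ P.gB f 1 0 ≤ P.gA f 1 0 ∧ 0 ≤ P.gA f 1 1 := by
  rw [mem_activeSet, forall_carrier]
  simp only [UniSet.cutVal_pt, UniSet.pt_mem_carrier]
  constructor
  · rintro ⟨-, h1, h2, h3, h4⟩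
    norm_num at *
    exact ⟨by linarith, by linarith, by linarith⟩
  · rintro ⟨h1, h2, h3⟩
    norm_num
    exact ⟨by linarith, by linarith, by linarith⟩

lemma active11 : P.pt 1 1 ∈ activeSet f P.carrier ↔
    P.gA f 0 0 + P.gB f 0 0 ≤ 0 ∧ P.gB f 1 0 ≤ 0 ∧ P.gA f 0 1 ≤ 0 := by
  rw [mem_activeSet, forall_carrier]
  simp only [UniSet.cutVal_pt, UniSet.pt_mem_carrier]
  constructor
  · rintro ⟨-, h1, h2, h3, h4⟩
    norm_num at *
    exact ⟨by linarith, by linarith, by linarith⟩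
  · rintro ⟨h1, h2, h3⟩
    norm_num
    exact ⟨by linarith, by linarith, by linarith⟩

/-- `w` minimises `f` on `S`. -/
def IsMinOf (f : Plane → ℝ) (S : Set Lattice2) (w : Lattice2) : Prop :=
  w ∈ S ∧ ∀ v ∈ S, latVal f w ≤ latVal f v

lemma finite_carrier (P : UniSet) : P.carrier.Finite := by
  have : P.carrier = {P.pt 0 0, P.pt 1 0, P.pt 0 1, P.pt 1 1} := by
    ext w; simp [P.mem_carrier]
  rw [this]
  exact Set.toFinite _

lemma exists_isMinOf (f : Plane → ℝ) (P : UniSet) : ∃ w, IsMinOf f P.carrier w := by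
  obtain ⟨w, hw, h⟩ := Set.exists_min_image P.carrier (latVal f) (finite_carrier P)
    ⟨P.pt 0 0, by simp [P.pt_mem_carrier]⟩
  exact ⟨w, hw, h⟩

lemma IsMinOf.mem_activeSet (hf : LatticeConvex f c) {S : Set Lattice2} {w : Lattice2}
    (h : IsMinOf f S w) : w ∈ activeSet f S :=
  ⟨h.1, fun v hv => hf.cutVal_nonpos (h.2 v hv)⟩

/-- If no vertex but the anchor is active, the anchor strictly cuts a neighbour. -/
lemma neighbour_cut (hf : LatticeConvex f c)
    (hA : ∀ w ∈ activeSet f P.carrier, w = P.pt 0 0) :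
    0 < P.gA f 0 0 ∨ 0 < P.gB f 0 0 := by
  by_contra hcon
  push Not at hcon
  -- The best of the other three vertices is inactive, and only the anchor can cut it. If it is the
  -- opposite vertex, a neighbour is cut as well, by linearity.
  obtain ⟨w, hw, hmin⟩ := Set.exists_min_image {P.pt 1 0, P.pt 0 1, P.pt 1 1} (latVal f)
    (Set.toFinite _) ⟨P.pt 1 0, by simp⟩
  have hwc : w ∈ P.carrier := by
    rw [P.mem_carrier]
    simp only [Set.mem_insert_iff, Set.mem_singleton_iff] at hw
    tauto
  have hw0 : w ≠ P.pt 0 0 := by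
    simp only [Set.mem_insert_iff, Set.mem_singleton_iff] at hw
    rcases hw with rfl | rfl | rfl <;> simp [P.pt_inj]
  obtain ⟨v, hv, hcut⟩ := exists_cut hwc (fun h => hw0 (hA w h))
  by_cases hv0 : v = P.pt 0 0
  · subst hv0
    simp only [Set.mem_insert_iff, Set.mem_singleton_iff] at hw
    rcases hw with rfl | rfl | rfl <;> rw [P.cutVal_pt] at hcut <;> norm_num at hcut <;>
      linarith [hcon.1, hcon.2]
  · have : v ∈ ({P.pt 1 0, P.pt 0 1, P.pt 1 1} : Set Lattice2) := by
      rw [P.mem_carrier] at hv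
      simp only [Set.mem_insert_iff, Set.mem_singleton_iff]
      tauto
    linarith [hmin v this, hf.drop hcut, hf.1]

/-- If the anchor is the only active vertex and does not cut `z + u¹`, then the interior lattice
points lie on the side of the anchor opposite to `u²`. -/
lemma single_flip_side (hf : LatticeConvex f c)
    (hA : activeSet f P.carrier = {P.pt 0 0}) (h0 : P.gA f 0 0 ≤ 0) {p q : ℤ}
    (hin : InIntr f P p q) : q ≤ -1 := by
  have hA' : ∀ w ∈ activeSet f P.carrier, w = P.pt 0 0 := by rw [hA]; simp
  have hB : 0 < P.gB f 0 0 := (neighbour_cut hf hA').resolve_left (not_lt.mpr h0)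
  have hz : P.pt 0 0 ∈ activeSet f P.carrier := by rw [hA]; simp
  rw [active00] at hz
  obtain ⟨z1, z2, z3⟩ := hz
  have hcutb := exists_cut (f := f) (S := P.carrier) (w := P.pt 1 0) (by simp [P.pt_mem_carrier])
    (by rw [hA]; simp [P.pt_inj])
  have hcute := exists_cut (f := f) (S := P.carrier) (w := P.pt 1 1) (by simp [P.pt_mem_carrier])
    (by rw [hA]; simp [P.pt_inj])
  rw [exists_carrier] at hcutb hcute
  obtain ⟨i1, i2, i3, i4⟩ := inIntr_iff.mp hin
  by_contra hq
  have hq0 : 0 ≤ q := by omega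
  have hqr : (0 : ℝ) ≤ q := by exact_mod_cast hq0
  have hp1 : 1 ≤ p := by
    by_contra hp
    have : (p : ℝ) ≤ 0 := by exact_mod_cast (by omega : p ≤ 0)
    nlinarith
  have hpr : (1 : ℝ) ≤ p := by exact_mod_cast hp1
  have case01 : ¬ P.gB f 0 1 < P.gA f 0 1 := by
    intro h
    have : (p : ℝ) * P.gA f 0 1 ≥ P.gA f 0 1 := by nlinarith
    nlinarith
  -- Neither the anchor nor `pt 0 1` cuts `pt 1 0`, so the opposite vertex does. As it does not cut
  -- the anchor, its half-plane forces `2 ≤ q` and `p < q`.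
  have hcut11 : 0 < cutVal f (P.pt 1 1) (P.pt 1 0) := by
    rcases hcutb with h | h | h | h
    · rw [P.cutVal_pt] at h; norm_num at h; linarith
    · rw [P.cutVal_pt] at h; norm_num at h
    · rw [P.cutVal_pt] at h; norm_num at h; exact absurd h case01
    · exact h
  have hB11 : P.gB f 1 1 < 0 := by
    have := hcut11
    rw [P.cutVal_pt] at this; norm_num at this; linarith
  have hA11 : 0 < P.gA f 1 1 := by linarith
  have hq2 : 2 ≤ q := by
    by_contra hlt
    have : (q : ℝ) ≤ 1 := by exact_mod_cast (by omega : q ≤ 1)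
    nlinarith
  have hqr2 : (2 : ℝ) ≤ q := by exact_mod_cast hq2
  have hpq : (p : ℝ) < q := by
    by_contra hle
    nlinarith
  -- Whichever vertex cuts `pt 1 1`: the anchor and `pt 0 1` would also cut `pt p q`, and `pt 1 0`
  -- would be in a mutual cut with `pt 1 1`.
  rcases hcute with h | h | h | h
  · rw [P.cutVal_pt] at h; norm_num at h
    nlinarith
  · exact absurd (hf.not_both h) (not_le.mpr hcut11)
  · rw [P.cutVal_pt] at h; norm_num at h
    nlinarith
  · rw [P.cutVal_pt] at h; norm_num at h

lemma IsOptimal.inIntr (hf : LatticeConvex f c) {p q : ℤ} (h : IsOptimal f (P.pt p q))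
    (hn : P.pt p q ∉ P.carrier) : InIntr f P p q := by
  intro v hv
  exact hf.cutVal_neg (by rintro rfl; exact hn hv) (h v)

/-! ### Rows of interior points -/

lemma cutVal_affine (f : Plane → ℝ) (P : UniSet) (v : Lattice2) (x y : ℤ) :
    cutVal f v (P.pt x y) = cutVal f v (P.pt 0 0)
      + x * (cutVal f v (P.pt 1 0) - cutVal f v (P.pt 0 0))
      + y * (cutVal f v (P.pt 0 1) - cutVal f v (P.pt 0 0)) := by
  obtain ⟨i, j, rfl⟩ := P.exists_pt v
  simp only [P.cutVal_pt]
  push_cast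
  ring

/-- The triangle on the active edge with apex `pt p (n * s)` meets row `s` in the segment from `p /
n` to `(p + n - 1) / n`. Accordingly, `n` times the point `(k, s)` is the combination of the apex,
`(1, 0)` and `(0, 0)` with weights `1`, `n * k - p` and `p + n - 1 - n * k`. -/
lemma row_point (hz : P.pt 0 0 ∈ activeSet f P.carrier) (hb : P.pt 1 0 ∈ activeSet f P.carrier)
    {s p n k : ℤ} (hn : 1 ≤ n) (hin : InIntr f P p (n * s)) (h1 : p ≤ n * k)
    (h2 : n * k ≤ p + n - 1) : InIntr f P k s := by
  intro v hv
  have a1 := hz.2 v hv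
  have a2 := hb.2 v hv
  have a3 := hin v hv
  change cutVal f v (P.pt 0 0) ≤ 0 at a1
  change cutVal f v (P.pt 1 0) ≤ 0 at a2
  have hn' : (1 : ℝ) ≤ n := by exact_mod_cast hn
  have h1' : (p : ℝ) ≤ n * k := by exact_mod_cast h1
  have h2' : (n : ℝ) * k ≤ p + n - 1 := by exact_mod_cast h2
  have key : n * cutVal f v (P.pt k s) = cutVal f v (P.pt p (n * s))
      + (n * k - p) * cutVal f v (P.pt 1 0) + (p + n - 1 - n * k) * cutVal f v (P.pt 0 0) := by
    rw [cutVal_affine f P v k s, cutVal_affine f P v p (n * s)]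
    push_cast
    ring
  have e1 : (n * k - p : ℝ) * cutVal f v (P.pt 1 0) ≤ 0 :=
    mul_nonpos_of_nonneg_of_nonpos (by linarith) a2
  have e2 : (p + n - 1 - n * k : ℝ) * cutVal f v (P.pt 0 0) ≤ 0 :=
    mul_nonpos_of_nonneg_of_nonpos (by linarith) a1
  by_contra hcon
  have : 0 ≤ n * cutVal f v (P.pt k s) := mul_nonneg (by linarith) (not_lt.mp hcon)
  linarith

lemma exists_row_point (hz : P.pt 0 0 ∈ activeSet f P.carrier)
    (hb : P.pt 1 0 ∈ activeSet f P.carrier) {s p n : ℤ} (hn : 1 ≤ n)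
    (hin : InIntr f P p (n * s)) : ∃ k, InIntr f P k s := by
  have e1 := Int.emod_nonneg (p + n - 1) (by omega : n ≠ 0)
  have e2 := Int.emod_lt_of_pos (p + n - 1) (by omega : 0 < n)
  have e3 := Int.emod_add_mul_ediv (p + n - 1) n
  -- The ceiling of `p / n` always lies in the window of `row_point`.
  exact ⟨(p + n - 1) / n, row_point hz hb hn hin (by omega) (by omega)⟩

/-- Some vertex `v` excludes `(k - 1, s)` but admits `(k, s)`. Dilation from the anchor by `n` moves
`(k - 1, s)` to row `n * s`; since the anchor satisfies the inequality of `v`, the image still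
violates it, and so does every point to its left. `row_upper` is the mirror image, dilating from `pt
1 0`. -/
lemma row_lower (hz : P.pt 0 0 ∈ activeSet f P.carrier) {s p n k : ℤ} (hn : 1 ≤ n)
    (hin : InIntr f P p (n * s)) (hk : InIntr f P k s) (hk1 : ¬ InIntr f P (k - 1) s) :
    n * (k - 1) + 1 ≤ p := by
  unfold InIntr at hk1
  push Not at hk1
  obtain ⟨v, hv, hk1⟩ := hk1
  have a1 : cutVal f v (P.pt 0 0) ≤ 0 := hz.2 v hv
  have a2 := hk v hv
  have a3 := hin v hv
  rw [cutVal_affine] at hk1 a2 a3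
  set α := cutVal f v (P.pt 1 0) - cutVal f v (P.pt 0 0)
  set β := cutVal f v (P.pt 0 1) - cutVal f v (P.pt 0 0)
  set γ := cutVal f v (P.pt 0 0)
  push_cast at *
  have hα : α < 0 := by nlinarith
  by_contra hcon
  have hp : (p : ℝ) ≤ n * (k - 1) := by exact_mod_cast (by omega : p ≤ n * (k - 1))
  have hn' : (1 : ℝ) ≤ n := by exact_mod_cast hn
  have e1 : 0 ≤ (n : ℝ) * (γ + (k - 1) * α + s * β) := mul_nonneg (by linarith) hk1
  have e2 : ((n : ℝ) * (k - 1)) * α ≤ p * α := mul_le_mul_of_nonpos_right hp hα.le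
  have e3 : ((n : ℝ) - 1) * γ ≤ 0 := mul_nonpos_of_nonneg_of_nonpos (by linarith) a1
  linarith

lemma row_upper (hb : P.pt 1 0 ∈ activeSet f P.carrier) {s p n k : ℤ} (hn : 1 ≤ n)
    (hin : InIntr f P p (n * s)) (hk : InIntr f P k s) (hk1 : ¬ InIntr f P (k + 1) s) :
    p ≤ n * k := by
  unfold InIntr at hk1
  push Not at hk1
  obtain ⟨v, hv, hk1⟩ := hk1
  have a1 : cutVal f v (P.pt 1 0) ≤ 0 := hb.2 v hv
  have a2 := hk v hv
  have a3 := hin v hv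
  rw [cutVal_affine] at hk1 a2 a3
  obtain ⟨γ, hγ⟩ : ∃ γ, γ = cutVal f v (P.pt 0 0) := ⟨_, rfl⟩
  obtain ⟨β, hβ⟩ : ∃ β, β = cutVal f v (P.pt 0 1) - cutVal f v (P.pt 0 0) := ⟨_, rfl⟩
  obtain ⟨α, hα'⟩ : ∃ α, α = cutVal f v (P.pt 1 0) - cutVal f v (P.pt 0 0) := ⟨_, rfl⟩
  rw [← hβ, ← hα', ← hγ] at hk1 a2 a3
  have a1' : γ + α ≤ 0 := by linarith
  push_cast at *
  have hα : 0 < α := by nlinarith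
  by_contra hcon
  have hp : (n : ℝ) * k + 1 ≤ p := by exact_mod_cast (by omega : n * k + 1 ≤ p)
  have hn' : (1 : ℝ) ≤ n := by exact_mod_cast hn
  have e1 : 0 ≤ (n : ℝ) * (γ + (k + 1) * α + s * β) := mul_nonneg (by linarith) hk1
  have e2 : ((n : ℝ) * k + 1) * α ≤ p * α := mul_le_mul_of_nonneg_right hp hα.le
  have e3 : ((n : ℝ) - 1) * (γ + α) ≤ 0 := mul_nonpos_of_nonneg_of_nonpos (by linarith) a1'
  linarith

lemma InIntr.between {s k l m : ℤ} (hk : InIntr f P k s) (hl : InIntr f P l s) (h1 : k ≤ m)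
    (h2 : m ≤ l) : InIntr f P m s := by
  intro v hv
  have a1 := hk v hv
  have a2 := hl v hv
  rw [cutVal_affine] at a1 a2 ⊢
  have h1' : (k : ℝ) ≤ m := by exact_mod_cast h1
  have h2' : (m : ℝ) ≤ l := by exact_mod_cast h2
  set α := cutVal f v (P.pt 1 0) - cutVal f v (P.pt 0 0)
  rcases le_total 0 α with h | h <;> nlinarith

/-- The midpoint of the two points lies on the line of the active edge and must be strictly between
its endpoints. Consequently, if both rows have interior points, each has exactly one. -/
lemma opposite_rows (hz : P.pt 0 0 ∈ activeSet f P.carrier)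
    (hb : P.pt 1 0 ∈ activeSet f P.carrier) {s k l : ℤ} (hk : InIntr f P k s)
    (hl : InIntr f P l (-s)) : k + l = 1 := by
  have h1 := (active00.mp hz).1
  have h2 := (active10.mp hb).1
  obtain ⟨k1, k2, -, -⟩ := inIntr_iff.mp hk
  obtain ⟨l1, l2, -, -⟩ := inIntr_iff.mp hl
  push_cast at *
  have h3 : (0 : ℝ) < k + l := by
    by_contra hcon
    nlinarith
  have h4 : (k + l : ℝ) < 2 := by
    by_contra hcon
    nlinarith
  have h3' : 0 < k + l := by exact_mod_cast h3
  have h4' : k + l < 2 := by exact_mod_cast h4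
  omega

lemma row_ne_zero (hz : P.pt 0 0 ∈ activeSet f P.carrier)
    (hb : P.pt 1 0 ∈ activeSet f P.carrier) {p q : ℤ} (h : InIntr f P p q) : q ≠ 0 := by
  rintro rfl
  have h1 := (active00.mp hz).1
  have h2 := (active10.mp hb).1
  obtain ⟨k1, k2, -, -⟩ := inIntr_iff.mp h
  push_cast at *
  have h3 : (0 : ℝ) < p := by
    by_contra hcon
    nlinarith
  have h4 : (p : ℝ) < 1 := by
    by_contra hcon
    nlinarith
  have h3' : 0 < p := by exact_mod_cast h3
  have h4' : p < 1 := by exact_mod_cast h4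
  omega

end Active

/-! ### The potential -/

/-- The distance of an integer to the set `{0, 1}`. -/
def dist01 (p : ℤ) : ℤ := max (-p) (p - 1)

/-- The larger of the distances of two integers to `{0, 1}`. -/
def rad (p q : ℤ) : ℤ := max (dist01 p) (dist01 q)

/-- `1` if `t ≤ 0` and `-1` otherwise. -/
noncomputable def descentSign (t : ℝ) : ℤ := if t ≤ 0 then 1 else -1

lemma descentSign_cases (t : ℝ) : (descentSign t = 1 ∧ t ≤ 0) ∨ (descentSign t = -1 ∧ 0 < t) := by
  unfold descentSign
  split_ifs with h
  · exact Or.inl ⟨rfl, h⟩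
  · exact Or.inr ⟨rfl, not_le.mp h⟩

open Classical in
/-- The potential of a preprocessed unimodular set, where `(p, q)` are the coordinates of an
optimal solution. -/
noncomputable def pot (f : Plane → ℝ) (P : UniSet) (p q : ℤ) : ℤ :=
  if activeSet f P.carrier = {P.pt 0 0} then
    3 * rad (descentSign (P.gA f 0 0) * p) (descentSign (P.gB f 0 0) * q)
  else if P.pt 1 0 ∈ activeSet f P.carrier then
    -- The cell lies on the side `q ≥ 0` of its active edge, the optimum on the other. The larger
    -- value pays for one reflection at this edge that leaves `rad` unchanged.
    if q ≤ -1 ∧ -q ≤ dist01 p then 3 * rad p q - 2 else 3 * rad p q - 4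
  else 3 * rad p q - 3

section Potential

variable {f : Plane → ℝ} {c : ℝ} {P Q N : UniSet} {p q p' q' : ℤ}

lemma UniSet.pt_zero (P : UniSet) : P.pt 0 0 = P.z := by simp [UniSet.pt]
lemma UniSet.pt_one_zero (P : UniSet) : P.pt 1 0 = P.z + P.u1 := by simp [UniSet.pt]
lemma UniSet.pt_zero_one (P : UniSet) : P.pt 0 1 = P.z + P.u2 := by simp [UniSet.pt]
lemma UniSet.pt_one_one (P : UniSet) : P.pt 1 1 = P.z + P.u1 + P.u2 := by simp [UniSet.pt]

lemma strictlyCuts_iff {x y : Lattice2} : StrictlyCuts f x y ↔ 0 < cutVal f x y := Iff.rfl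

lemma activeSet_eq_of (hz : P.pt 0 0 ∈ activeSet f P.carrier) :
    ∀ w, w ∈ activeSet f P.carrier ↔ w = P.pt 0 0 ∨
      (w = P.pt 1 0 ∧ P.pt 1 0 ∈ activeSet f P.carrier) ∨
      (w = P.pt 0 1 ∧ P.pt 0 1 ∈ activeSet f P.carrier) ∨
      (w = P.pt 1 1 ∧ P.pt 1 1 ∈ activeSet f P.carrier) := by
  intro w
  constructor
  · intro h
    rcases P.mem_carrier.mp h.1 with rfl | rfl | rfl | rfl <;> tauto
  · rintro (rfl | ⟨rfl, h⟩ | ⟨rfl, h⟩ | ⟨rfl, h⟩) <;> assumption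

lemma Preprocessed.anchor_mem (h : Preprocessed f P) : P.pt 0 0 ∈ activeSet f P.carrier := by
  refine ⟨by simp [P.pt_mem_carrier], ?_⟩
  rw [P.pt_zero]
  exact h.1

/-- The shapes of the active set of a preprocessed set. -/
lemma Preprocessed.shape (h : Preprocessed f P) :
    activeSet f P.carrier = {P.pt 0 0} ∨
    activeSet f P.carrier = {P.pt 0 0, P.pt 1 0} ∨
    (activeSet f P.carrier = {P.pt 0 0, P.pt 1 1} ∧ 0 < P.gA f 0 0 ∧ P.gA f 1 1 < 0) ∨
    activeSet f P.carrier = {P.pt 0 0, P.pt 1 0, P.pt 0 1} ∨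
    (P.pt 0 0 ∈ activeSet f P.carrier ∧ P.pt 1 0 ∈ activeSet f P.carrier ∧
      P.pt 0 1 ∈ activeSet f P.carrier ∧ P.pt 1 1 ∈ activeSet f P.carrier) := by
  have hz := h.anchor_mem
  have hA := activeSet_eq_of hz
  obtain ⟨-, h2, h3⟩ := h
  rw [← P.pt_one_zero, ← P.pt_zero_one, ← P.pt_zero] at h3
  rw [← P.pt_one_one, ← P.pt_one_zero, ← P.pt_zero_one, ← P.pt_zero,
    strictlyCuts_iff, strictlyCuts_iff] at h2
  have two : ∀ {a b : Lattice2}, a ≠ b → ({a, b} : Set Lattice2).ncard = 2 :=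
    fun hab => Set.ncard_pair hab
  have three : ∀ {a b d : Lattice2}, a ≠ b → a ≠ d → b ≠ d →
      ({a, b, d} : Set Lattice2).ncard = 3 := by
    intro a b d h1 h2 h3
    exact Set.ncard_eq_three.mpr ⟨a, b, d, h1, h2, h3, rfl⟩
  by_cases hb : P.pt 1 0 ∈ activeSet f P.carrier <;>
  by_cases hd : P.pt 0 1 ∈ activeSet f P.carrier <;>
  by_cases he : P.pt 1 1 ∈ activeSet f P.carrier <;>
  simp only [hb, hd, he, and_true, and_false, or_false, false_or] at hA
  · right; right; right; right; exact ⟨hz, hb, hd, he⟩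
  · right; right; right; left
    ext w; rw [hA]; simp
  · have e : activeSet f P.carrier = {P.pt 0 0, P.pt 1 0, P.pt 1 1} := by ext w; rw [hA]; simp
    have := h3 (by rw [e]; apply three <;> simp [P.pt_inj])
    rw [this] at he
    simp [P.pt_inj] at he
  · right; left; ext w; rw [hA]; simp
  · have e : activeSet f P.carrier = {P.pt 0 0, P.pt 0 1, P.pt 1 1} := by ext w; rw [hA]; simp
    have := h3 (by rw [e]; apply three <;> simp [P.pt_inj])
    rw [this] at he
    simp [P.pt_inj] at he
  · have e : activeSet f P.carrier = {P.pt 0 0, P.pt 0 1} := by ext w; rw [hA]; simp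
    rcases h2 (by rw [e]; exact two (by simp [P.pt_inj])) with h | ⟨h, -⟩ <;>
    · rw [h] at hd
      simp [P.pt_inj] at hd
  · right; right; left
    have e : activeSet f P.carrier = {P.pt 0 0, P.pt 1 1} := by ext w; rw [hA]; simp
    refine ⟨e, ?_⟩
    rcases h2 (by rw [e]; exact two (by simp [P.pt_inj])) with h | ⟨-, h1, h2⟩
    · rw [h] at he
      simp [P.pt_inj] at he
    · rw [P.cutVal_pt] at h1 h2
      norm_num at h1 h2
      exact ⟨h1, h2⟩
  · left; ext w; rw [hA]; simp

/-! ### Dependence of the potential on the labelling -/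

lemma relabel_coords (hc : Q.carrier = N.carrier) (hpt : Q.pt p' q' = N.pt p q) :
    ∃ i j : ℤ, (i = 0 ∨ i = 1) ∧ (j = 0 ∨ j = 1) ∧
      (((∀ x y, Q.pt x y = N.pt (i + (1 - 2 * i) * x) (j + (1 - 2 * j) * y)) ∧
          p = i + (1 - 2 * i) * p' ∧ q = j + (1 - 2 * j) * q') ∨
        ((∀ x y, Q.pt x y = N.pt (i + (1 - 2 * i) * y) (j + (1 - 2 * j) * x)) ∧
          p = i + (1 - 2 * i) * q' ∧ q = j + (1 - 2 * j) * p')) := by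
  obtain ⟨i, j, hi, hj, h | h⟩ := N.relabel Q hc
  · refine ⟨i, j, hi, hj, Or.inl ⟨h, ?_⟩⟩
    rw [h, N.pt_inj] at hpt
    exact ⟨hpt.1.symm, hpt.2.symm⟩
  · refine ⟨i, j, hi, hj, Or.inr ⟨h, ?_⟩⟩
    rw [h, N.pt_inj] at hpt
    exact ⟨hpt.1.symm, hpt.2.symm⟩

/-- The pair of distances does not depend on the labelling, up to order. -/
lemma dist01_relabel (hc : Q.carrier = N.carrier) (hpt : Q.pt p' q' = N.pt p q) :
    (dist01 p' = dist01 p ∧ dist01 q' = dist01 q) ∨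
      (dist01 p' = dist01 q ∧ dist01 q' = dist01 p) := by
  unfold dist01
  obtain ⟨i, j, rfl | rfl, rfl | rfl, ⟨-, h1, h2⟩ | ⟨-, h1, h2⟩⟩ := relabel_coords hc hpt <;> omega

lemma rad_relabel (hc : Q.carrier = N.carrier) (hpt : Q.pt p' q' = N.pt p q) :
    rad p' q' = rad p q := by
  have := dist01_relabel hc hpt
  unfold rad
  omega

/-- A change of sign alters the distance of an integer to `{0, 1}` by at most one. -/
lemma rad_descent_le (s t : ℝ) :
    rad (descentSign s * p) (descentSign t * q) ≤ rad p q + 1 := by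
  unfold rad dist01
  rcases descentSign_cases s with ⟨h, -⟩ | ⟨h, -⟩ <;>
    rcases descentSign_cases t with ⟨h', -⟩ | ⟨h', -⟩ <;> rw [h, h'] <;> omega

lemma pot_le (hc : Q.carrier = N.carrier) (hpt : Q.pt p' q' = N.pt p q) :
    pot f Q p' q' ≤ 3 * rad p q + 3 := by
  have h1 := rad_relabel hc hpt
  have h2 := rad_descent_le (p := p') (q := q') (Q.gA f 0 0) (Q.gB f 0 0)
  unfold pot
  split_ifs <;> omega

lemma pot_le_of_not_single (hc : Q.carrier = N.carrier) (hpt : Q.pt p' q' = N.pt p q)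
    (hs : ∀ w, activeSet f N.carrier ≠ {w}) : pot f Q p' q' ≤ 3 * rad p q - 2 := by
  have h1 := rad_relabel hc hpt
  have h3 : activeSet f Q.carrier ≠ {Q.pt 0 0} := by rw [hc]; exact hs _
  unfold pot
  rw [if_neg h3]
  split_ifs <;> omega

/-- Connectedness is a property of the set, but every preprocessed labelling exhibits it:
relabelling preserves adjacency, which excludes the single and the diagonal shape, and all other
shapes contain `pt 1 0`. -/
lemma connected_anchor (hQ : Preprocessed f Q) (hconn : IsConnectedCell f Q.carrier) :
    activeSet f Q.carrier ≠ {Q.pt 0 0} ∧ Q.pt 1 0 ∈ activeSet f Q.carrier := by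
  obtain ⟨M, hM, m1, m2⟩ := hconn
  rw [← M.pt_zero] at m1
  rw [← M.pt_one_zero] at m2
  obtain ⟨i, j, hi, hj, h⟩ := Q.relabel M hM
  rcases hQ.shape with h1 | h1 | ⟨h1, -⟩ | h1 | ⟨h0, h1, -⟩
  · rw [h1, Set.mem_singleton_iff] at m1 m2
    have := m1.trans m2.symm
    simp [M.pt_inj] at this
  · rw [h1]
    refine ⟨fun h => ?_, by simp⟩
    have : Q.pt 1 0 ∈ ({Q.pt 0 0} : Set Lattice2) := by rw [← h]; simp
    simp [Q.pt_inj] at this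
  · exfalso
    rw [h1] at m1 m2
    simp only [Set.mem_insert_iff, Set.mem_singleton_iff] at m1 m2
    rcases h with h | h <;> rw [h, Q.pt_inj, Q.pt_inj] at m1 m2 <;> omega
  · rw [h1]
    refine ⟨fun h => ?_, by simp⟩
    have : Q.pt 1 0 ∈ ({Q.pt 0 0} : Set Lattice2) := by rw [← h]; simp
    simp [Q.pt_inj] at this
  · refine ⟨fun h => ?_, h1⟩
    rw [h] at h1
    simp [Q.pt_inj] at h1

/-- Used where a diagonal flip leaves `rad` unchanged. The exceptional value `-2` needs both
coordinates outside `{0, 1}`. -/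
lemma pot_connected (hc : Q.carrier = N.carrier) (hpt : Q.pt p' q' = N.pt p q)
    (hQ : Preprocessed f Q) (hconn : IsConnectedCell f N.carrier)
    (hmin : dist01 p = 0 ∨ dist01 q = 0) : pot f Q p' q' = 3 * rad p q - 4 := by
  have h1 := rad_relabel hc hpt
  have h2 := dist01_relabel hc hpt
  obtain ⟨h3, h4⟩ := connected_anchor hQ (by rwa [hc])
  unfold pot
  rw [if_neg h3, if_pos h4, if_neg, h1]
  rintro ⟨a, b⟩
  unfold dist01 at *
  omega

lemma gA_eq_cutVal : P.gA f 0 0 = cutVal f (P.pt 0 0) (P.pt 1 0) := by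
  rw [P.cutVal_pt]; norm_num

lemma gB_eq_cutVal : P.gB f 0 0 = cutVal f (P.pt 0 0) (P.pt 0 1) := by
  rw [P.cutVal_pt]; norm_num

/-- The anchor is forced to be the active vertex, so only the order of the columns is free, and the
formula is symmetric in it. -/
lemma pot_single (hc : Q.carrier = N.carrier) (hpt : Q.pt p' q' = N.pt p q)
    (hQ : Preprocessed f Q) (hs : activeSet f N.carrier = {N.pt 0 0}) :
    pot f Q p' q' =
      3 * rad (descentSign (N.gA f 0 0) * p) (descentSign (N.gB f 0 0) * q) := by
  have hz := hQ.anchor_mem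
  have hz' : Q.pt 0 0 = N.pt 0 0 := by rw [hc, hs] at hz; exact hz
  have hs' : activeSet f Q.carrier = {Q.pt 0 0} := by rw [hc, hs, hz']
  unfold pot
  rw [if_pos hs']
  obtain ⟨i, j, hi, hj, ⟨h, h1, h2⟩ | ⟨h, h1, h2⟩⟩ := relabel_coords hc hpt
  · rw [h, N.pt_inj] at hz'
    obtain rfl : i = 0 := by omega
    obtain rfl : j = 0 := by omega
    rw [gA_eq_cutVal, gB_eq_cutVal, gA_eq_cutVal, gB_eq_cutVal, h, h, h, h1, h2]
    norm_num
  · rw [h, N.pt_inj] at hz'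
    obtain rfl : i = 0 := by omega
    obtain rfl : j = 0 := by omega
    rw [gA_eq_cutVal, gB_eq_cutVal, gA_eq_cutVal, gB_eq_cutVal, h, h, h, h1, h2]
    norm_num [rad, max_comm]

end Potential

/-! ### The effect of a flip on the potential -/

section Flips

variable {f : Plane → ℝ} {c : ℝ} {P Q N : UniSet} {p q p' q' : ℤ}

/-- The potential does not increase by more than five, and it drops unless all minimisers of `f`
on the old set are cut by the new one. -/
def StepBound (f : Plane → ℝ) (P Q : UniSet) (p q p' q' : ℤ) : Prop :=
  pot f Q p' q' ≤ pot f P p q + 5 ∧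
    ∀ w, IsMinOf f P.carrier w → w ∈ activeSet f Q.carrier → pot f Q p' q' + 1 ≤ pot f P p q

lemma not_single_of {S : Set Lattice2} {w y : Lattice2} (hw : w ∈ activeSet f S)
    (hy : y ∈ activeSet f S) (h : w ≠ y) : ∀ v, activeSet f S ≠ {v} := by
  intro v hv
  rw [hv] at hw hy
  exact h (hw.trans hy.symm)

lemma single_eq {S : Set Lattice2} {w v : Lattice2} (hw : w ∈ activeSet f S)
    (hv : activeSet f S = {v}) : activeSet f S = {w} := by
  rw [hv] at hw
  rw [hv, Set.mem_singleton_iff.mp hw]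

lemma sub_carrier_of_coords (P N : UniSet) (i j : ℤ) (hi : i = 0 ∨ i = 1) (hj : j = 0 ∨ j = 1)
    (h : (∀ x y, N.pt x y = P.pt (i + (1 - 2 * i) * x) (j + (1 - 2 * j) * y)) ∨
      (∀ x y, N.pt x y = P.pt (i + (1 - 2 * i) * y) (j + (1 - 2 * j) * x))) :
    N.carrier = P.carrier := by
  ext w
  rw [N.mem_carrier, P.mem_carrier]
  rcases h with h | h <;> simp only [h] <;> rcases hi with rfl | rfl <;>
    rcases hj with rfl | rfl <;> norm_num <;> tauto

/-- The potential of a single vertex is already measured in the new cell. There `w` cannot be the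
only active vertex, since it would have to cut a neighbour, whereas both new columns are directions
of nonpositive derivative at `w`. -/
lemma step_single (hf : LatticeConvex f c) (hA : activeSet f P.carrier = {P.pt 0 0})
    {a b : ℤ} (ha : a = descentSign (P.gA f 0 0)) (hb : b = descentSign (P.gB f 0 0))
    (hdet : |a * b - 0 * 0| = 1) (hc : Q.carrier = (P.sub 0 0 a 0 0 b hdet).carrier)
    (hpt : Q.pt p' q' = P.pt p q) : StepBound f P Q p q p' q' := by
  have hpt' : Q.pt p' q' = (P.sub 0 0 a 0 0 b hdet).pt (a * p) (b * q) := by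
    rw [hpt, P.sub_pt]
    have e1 : a * a = 1 := by
      rcases descentSign_cases (P.gA f 0 0) with ⟨h, -⟩ | ⟨h, -⟩ <;> rw [ha, h] <;> norm_num
    have e2 : b * b = 1 := by
      rcases descentSign_cases (P.gB f 0 0) with ⟨h, -⟩ | ⟨h, -⟩ <;> rw [hb, h] <;> norm_num
    congr 1
    · linear_combination (-p) * e1
    · linear_combination (-q) * e2
  have hP : pot f P p q = 3 * rad (a * p) (b * q) := by
    unfold pot
    rw [if_pos hA, ha, hb]
  refine ⟨by have := pot_le (f := f) hc hpt'; omega, fun w hw hwA => ?_⟩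
  have hw0 : w = P.pt 0 0 := by
    have := hw.mem_activeSet hf
    rwa [hA] at this
  rw [hc] at hwA
  have := pot_le_of_not_single (f := f) hc hpt' ?_
  · omega
  · intro v hv
    have hs := single_eq hwA hv
    have hN : (P.sub 0 0 a 0 0 b hdet).pt 0 0 = P.pt 0 0 := by rw [P.sub_pt]; simp
    rcases neighbour_cut (P := P.sub 0 0 a 0 0 b hdet) hf
      (by rw [hs, hw0, hN]; simp) with h | h
    · rw [P.gA_sub] at h
      norm_num at h
      rcases descentSign_cases (P.gA f 0 0) with ⟨h', h''⟩ | ⟨h', h''⟩ <;> rw [ha, h'] at h <;>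
        norm_num at h <;> linarith
    · rw [P.gB_sub] at h
      norm_num at h
      rcases descentSign_cases (P.gB f 0 0) with ⟨h', h''⟩ | ⟨h', h''⟩ <;> rw [hb, h'] at h <;>
        norm_num at h <;> linarith

lemma pot_edge (hb : P.pt 1 0 ∈ activeSet f P.carrier) :
    (q ≤ -1 ∧ -q ≤ dist01 p ∧ pot f P p q = 3 * rad p q - 2) ∨
      (¬ (q ≤ -1 ∧ -q ≤ dist01 p) ∧ pot f P p q = 3 * rad p q - 4) := by
  have : activeSet f P.carrier ≠ {P.pt 0 0} := by
    intro h
    rw [h] at hb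
    simp [P.pt_inj] at hb
  unfold pot
  rw [if_neg this, if_pos hb]
  split_ifs with h
  · exact Or.inl ⟨h.1, h.2, rfl⟩
  · exact Or.inr ⟨h, rfl⟩

lemma InIntr.not_of_not_active {x y : ℤ} (hc : P.pt x y ∈ P.carrier)
    (h : P.pt x y ∉ activeSet f P.carrier) : ¬ InIntr f P x y := by
  intro hin
  exact h ⟨hc, fun v hv => (hin v hv).le⟩

/-- As `k` is alone in its row, `row_lower` and `row_upper` confine `p` to the `n` values up to `n *
k`. In the new cell the optimum is `(m + n, m)` with `1 - n ≤ m ≤ 0`, so `rad` falls from at least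
`n` to at most `n - 1`. -/
lemma step_unique_row (hf : LatticeConvex f c)
    (hA : activeSet f P.carrier = {P.pt 0 0, P.pt 1 0}) {s k n : ℤ} (hs : s = 1 ∨ s = -1)
    (hn : 1 ≤ n) (hq : q = n * s) (hin : InIntr f P p q) (hk : InIntr f P k s)
    (huniq : ∀ l, InIntr f P l s → l = k) (hdet : |k * (-s) - (1 - k) * s| = 1)
    (hc : Q.carrier = (P.sub 0 0 k s (1 - k) (-s) hdet).carrier)
    (hpt : Q.pt p' q' = P.pt p q) (hQ : Preprocessed f Q)
    (hinQ : ∀ v ∈ Q.carrier, cutVal f v (P.pt p q) < 0) : StepBound f P Q p q p' q' := by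
  have hz : P.pt 0 0 ∈ activeSet f P.carrier := by rw [hA]; simp
  have hb : P.pt 1 0 ∈ activeSet f P.carrier := by rw [hA]; simp
  have hd := InIntr.not_of_not_active (f := f) (P := P) (x := 0) (y := 1)
    (by simp [P.pt_mem_carrier]) (by rw [hA]; simp [P.pt_inj])
  have he := InIntr.not_of_not_active (f := f) (P := P) (x := 1) (y := 1)
    (by simp [P.pt_mem_carrier]) (by rw [hA]; simp [P.pt_inj])
  subst hq
  have hlow := row_lower hz hn hin hk (fun h => by have := huniq _ h; omega)
  have hupp := row_upper hb hn hin hk (fun h => by have := huniq _ h; omega)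
  set N := P.sub 0 0 k s (1 - k) (-s) hdet with hN
  have hNpt : ∀ x y, N.pt x y = P.pt (x * k + y * (1 - k)) (x * s - y * s) := by
    intro x y
    rw [hN, P.sub_pt]
    congr 1 <;> ring
  obtain ⟨m, hm⟩ : ∃ m, m = p - n * k := ⟨_, rfl⟩
  have hm1 : 1 - n ≤ m := by rw [hm]; linarith
  have hm2 : m ≤ 0 := by omega
  have hzs : N.pt (m + n) m = P.pt p (n * s) := by
    rw [hNpt, hm]
    congr 1 <;> ring
  have hpt' : Q.pt p' q' = N.pt (m + n) m := by rw [hpt, hzs]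
  have hinN : InIntr f N (m + n) m := by
    intro v hv
    rw [hzs]
    exact hinQ v (by rwa [hc])
  have hR' : rad (m + n) m ≤ n - 1 := by unfold rad dist01; omega
  -- For `s = 1` the second coordinate contributes only `n - 1`. But `(0, 1)` and `(1, 1)` are
  -- inactive vertices, so `k` is neither `0` nor `1`, which pushes `p` away by `n`.
  have hR : n ≤ rad p (n * s) := by
    rcases hs with rfl | rfl
    · have hk0 : k ≠ 0 := by rintro rfl; exact hd hk
      have hk1 : k ≠ 1 := by rintro rfl; exact he hk
      have : n ≤ dist01 p := by
        unfold dist01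
        rcases lt_or_ge k 1 with h | h
        · have : n * k ≤ -n := by nlinarith [(by omega : k ≤ -1)]
          omega
        · have : n ≤ n * (k - 1) := by nlinarith [(by omega : 1 ≤ k - 1)]
          omega
      unfold rad
      omega
    · unfold rad dist01
      omega
  have hP := pot_edge (p := p) (q := n * s) hb
  refine ⟨by have := pot_le (f := f) hc hpt'; omega, fun w hw hwA => ?_⟩
  rw [hc] at hwA
  suffices pot f Q p' q' ≤ 3 * n - 5 by omega
  by_cases hsing : ∀ v, activeSet f N.carrier ≠ {v}
  · have := pot_le_of_not_single (f := f) hc hpt' hsing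
    omega
  push Not at hsing
  obtain ⟨v, hv⟩ := hsing
  have hwN := single_eq hwA hv
  have hwP := hw.mem_activeSet hf
  rw [hA] at hwP
  simp only [Set.mem_insert_iff, Set.mem_singleton_iff] at hwP
  rcases hwP with rfl | rfl
  -- If only the anchor survives, `single_flip_side` yields `m ≤ -1`, and reflecting the second
  -- column lowers `rad` to at most `n - 2`.
  · have h0 : N.pt 0 0 = P.pt 0 0 := by rw [hNpt]; norm_num
    rw [← h0] at hwN
    have hg : N.gA f 0 0 < 0 := by
      rw [gA_eq_cutVal, h0, hNpt]
      norm_num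
      exact hk _ hz.1
    have hside := single_flip_side hf hwN hg.le hinN
    have hg2 := (neighbour_cut (P := N) hf (by rw [hwN]; simp)).resolve_left (not_lt.mpr hg.le)
    rw [pot_single hc hpt' hQ hwN]
    unfold descentSign
    rw [if_pos hg.le, if_neg (not_le.mpr hg2)]
    unfold rad dist01
    omega
  -- The same argument at the other endpoint, with the cell read from `pt 1 0` and its columns
  -- interchanged.
  · set M := N.sub 1 1 0 (-1) (-1) 0 (by norm_num) with hM
    have hMpt : ∀ x y, M.pt x y = N.pt (1 - y) (1 - x) := by
      intro x y
      rw [hM, N.sub_pt]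
      congr 1 <;> ring
    have hMc : M.carrier = N.carrier := by
      apply sub_carrier_of_coords N M 1 1 (by simp) (by simp)
      right
      intro x y
      rw [hMpt]
      congr 1 <;> ring
    have h0 : M.pt 0 0 = P.pt 1 0 := by rw [hMpt, hNpt]; norm_num
    have hMzs : M.pt (1 - m) (1 - (m + n)) = N.pt (m + n) m := by
      rw [hMpt]
      congr 1 <;> ring
    rw [← h0, ← hMc] at hwN
    have hg : M.gA f 0 0 < 0 := by
      rw [gA_eq_cutVal, h0, hMpt, hNpt]
      norm_num
      exact hk _ hb.1
    have hinM : InIntr f M (1 - m) (1 - (m + n)) := by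
      intro v hv
      rw [hMzs]
      exact hinN v (by rwa [← hMc])
    have hside := single_flip_side hf hwN hg.le hinM
    have hg2 := (neighbour_cut (P := M) hf (by rw [hwN]; simp)).resolve_left (not_lt.mpr hg.le)
    rw [pot_single (hc.trans hMc.symm) (hpt'.trans hMzs.symm) hQ hwN]
    unfold descentSign
    rw [if_pos hg.le, if_neg (not_le.mpr hg2)]
    unfold rad dist01
    omega

/-! ### Four or three active vertices -/

/-- If all four vertices are active, there is no interior lattice point. -/
lemma not_all_active (hz : P.pt 0 0 ∈ activeSet f P.carrier)
    (hb : P.pt 1 0 ∈ activeSet f P.carrier) (hd : P.pt 0 1 ∈ activeSet f P.carrier)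
    (he : P.pt 1 1 ∈ activeSet f P.carrier) : ¬ InIntr f P p q := by
  intro hin
  obtain ⟨z1, z2, z3⟩ := active00.mp hz
  obtain ⟨b1, b2, b3⟩ := active10.mp hb
  obtain ⟨d1, d2, d3⟩ := active01.mp hd
  obtain ⟨e1, e2, e3⟩ := active11.mp he
  obtain ⟨i1, i2, i3, i4⟩ := inIntr_iff.mp hin
  -- Each lattice point lies in the outer quadrant of one vertex, and activity of the two neighbours
  -- makes the half-plane of that vertex miss the quadrant.
  rcases lt_or_ge p 1 with h | h <;> rcases lt_or_ge q 1 with h' | h'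
  · have h1 : (p : ℝ) ≤ 0 := by exact_mod_cast (by omega : p ≤ 0)
    have h2 : (q : ℝ) ≤ 0 := by exact_mod_cast (by omega : q ≤ 0)
    nlinarith
  · have h1 : (p : ℝ) ≤ 0 := by exact_mod_cast (by omega : p ≤ 0)
    have h2 : (1 : ℝ) ≤ q := by exact_mod_cast h'
    nlinarith
  · have h1 : (1 : ℝ) ≤ p := by exact_mod_cast h
    have h2 : (q : ℝ) ≤ 0 := by exact_mod_cast (by omega : q ≤ 0)
    nlinarith
  · have h1 : (1 : ℝ) ≤ p := by exact_mod_cast h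
    have h2 : (1 : ℝ) ≤ q := by exact_mod_cast h'
    nlinarith

/-- The inactive vertex `pt 1 1` is cut by `pt 1 0` or by `pt 0 1`; interior points with `q ≥ 1`
require the latter. As `pt 0 1` cuts `pt 1 1` but not `pt 1 0`, its inequality alone gives both
bounds. -/
lemma corner_upper (hA : activeSet f P.carrier = {P.pt 0 0, P.pt 1 0, P.pt 0 1})
    (hin : InIntr f P p q) (hq : 1 ≤ q) : p ≤ -1 ∧ q ≤ -p := by
  obtain ⟨z1, z2, z3⟩ := active00.mp (by rw [hA]; simp : P.pt 0 0 ∈ activeSet f P.carrier)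
  obtain ⟨b1, b2, b3⟩ := active10.mp (by rw [hA]; simp : P.pt 1 0 ∈ activeSet f P.carrier)
  obtain ⟨d1, d2, d3⟩ := active01.mp (by rw [hA]; simp : P.pt 0 1 ∈ activeSet f P.carrier)
  obtain ⟨i1, i2, i3, i4⟩ := inIntr_iff.mp hin
  have he : ¬ (P.gA f 0 0 + P.gB f 0 0 ≤ 0 ∧ P.gB f 1 0 ≤ 0 ∧ P.gA f 0 1 ≤ 0) := by
    rw [← active11, hA]; simp [P.pt_inj]
  have hqr : (1 : ℝ) ≤ q := by exact_mod_cast hq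
  have hs : 0 < P.gA f 0 1 := by
    by_contra hs
    have ht : 0 < P.gB f 1 0 := by
      by_contra ht
      exact he ⟨by linarith, by linarith, by linarith⟩
    have hp : p ≤ 0 := by
      by_contra hp
      have : (1 : ℝ) ≤ p := by exact_mod_cast (by omega : 1 ≤ p)
      nlinarith
    have : (p : ℝ) ≤ 0 := by exact_mod_cast hp
    nlinarith
  have hp : (p : ℝ) < 0 := by nlinarith
  have hpq : (q : ℝ) - 1 < -p := by
    by_contra hcon
    nlinarith
  constructor
  · have : p < 0 := by exact_mod_cast hp
    omega
  · have : q - 1 < -p := by exact_mod_cast hpq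
    omega

lemma corner_lower (hA : activeSet f P.carrier = {P.pt 0 0, P.pt 1 0, P.pt 0 1})
    (hin : InIntr f P p q) (hq : q ≤ -1) : 1 ≤ p ∧ p ≤ -q := by
  obtain ⟨b1, -, -⟩ := active10.mp (by rw [hA]; simp : P.pt 1 0 ∈ activeSet f P.carrier)
  obtain ⟨d1, -, -⟩ := active01.mp (by rw [hA]; simp : P.pt 0 1 ∈ activeSet f P.carrier)
  have i1 := (inIntr_iff.mp hin).1
  have hqr : (q : ℝ) ≤ -1 := by exact_mod_cast hq
  have hp : 1 ≤ p := by
    by_contra hp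
    have : (p : ℝ) ≤ 0 := by exact_mod_cast (by omega : p ≤ 0)
    nlinarith
  refine ⟨hp, ?_⟩
  set M := P.sub 0 0 0 1 1 0 (by norm_num) with hM
  have hMpt : ∀ x y, M.pt x y = P.pt y x := by
    intro x y
    rw [hM, P.sub_pt]
    congr 1 <;> ring
  have hMc : M.carrier = P.carrier := by
    apply sub_carrier_of_coords P M 0 0 (by simp) (by simp)
    right
    intro x y
    rw [hMpt]
    congr 1 <;> ring
  have hMA : activeSet f M.carrier = {M.pt 0 0, M.pt 1 0, M.pt 0 1} := by
    rw [hMc, hA]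
    simp only [hMpt]
    ext w
    simp only [Set.mem_insert_iff, Set.mem_singleton_iff]
    tauto
  exact (corner_upper (p := q) (q := p) hMA (fun v hv => by
    rw [hMpt]; exact hin v (by rwa [← hMc])) hp).2

lemma pot_corner (hA : activeSet f P.carrier = {P.pt 0 0, P.pt 1 0, P.pt 0 1})
    (hin : InIntr f P p q) : pot f P p q = 3 * rad p q - 4 := by
  rcases pot_edge (p := p) (q := q) (by rw [hA]; simp : P.pt 1 0 ∈ activeSet f P.carrier) with
    ⟨h1, h2, -⟩ | ⟨-, h⟩
  · have := corner_lower hA hin h1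
    unfold dist01 at h2
    omega
  · exact h

lemma active_of_intr {y : Lattice2} (hy : y ∈ N.carrier)
    (h : ∀ v ∈ N.carrier, v ≠ y → v ∈ P.carrier) (hin : ∀ v ∈ P.carrier, cutVal f v y < 0) :
    y ∈ activeSet f N.carrier := by
  refine ⟨hy, fun v hv => ?_⟩
  by_cases hvy : v = y
  · subst hvy
    exact (cutVal_self f v).le
  · exact (hin v (h v hv hvy)).le

/-- The new cell has one new vertex, interior to the old polyhedron and hence active. Together with
a surviving `w` this excludes the single shape. -/
lemma step_corner_aux (hA : activeSet f P.carrier = {P.pt 0 0, P.pt 1 0, P.pt 0 1}) (hin : InIntr f P p q)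
    {x y a b : ℤ} (hc : Q.carrier = N.carrier) (hpt : Q.pt p' q' = N.pt a b)
    (hyc : P.pt x y ∈ N.carrier)
    (hyN : ∀ v ∈ N.carrier, v ≠ P.pt x y → v ∈ P.carrier) (hy : InIntr f P x y)
    (hyP : P.pt x y ∉ P.carrier) (hrad : rad a b ≤ rad p q - 1) :
    StepBound f P Q p q p' q' := by
  have hP := pot_corner hA hin
  refine ⟨by have := pot_le (f := f) hc hpt; omega, fun w hw hwA => ?_⟩
  rw [hc] at hwA
  have := pot_le_of_not_single (f := f) hc hpt
    (not_single_of hwA (active_of_intr hyc hyN hy) (by rintro rfl; exact hyP hw.1))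
  omega

lemma step_corner_pos (hA : activeSet f P.carrier = {P.pt 0 0, P.pt 1 0, P.pt 0 1}) (hin : InIntr f P p q)
    {k : ℤ} (hk : InIntr f P k 1) (hdet : |(1 : ℤ) * 1 - (-1) * 0| = 1)
    (hc : Q.carrier = (P.sub 0 0 1 0 (-1) 1 hdet).carrier) (hpt : Q.pt p' q' = P.pt p q) :
    StepBound f P Q p q p' q' := by
  have hz : P.pt 0 0 ∈ activeSet f P.carrier := by rw [hA]; simp
  have hb : P.pt 1 0 ∈ activeSet f P.carrier := by rw [hA]; simp
  have hd : P.pt 0 1 ∈ activeSet f P.carrier := by rw [hA]; simp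
  have hk1 := (corner_upper hA hk le_rfl).1
  obtain ⟨b1, -, -⟩ := active10.mp hb
  obtain ⟨d1, -, -⟩ := active01.mp hd
  -- Interior points on both sides of the edge would impose opposite comparisons of the two
  -- derivatives at the anchor.
  have hq : 1 ≤ q := by
    by_contra hq
    have hq0 := row_ne_zero hz hb hin
    have hpq := corner_lower hA hin (by omega)
    have i1 := (inIntr_iff.mp hin).1
    have k1 := (inIntr_iff.mp hk).1
    have r1 : (k : ℝ) ≤ -1 := by exact_mod_cast hk1
    have r2 : (1 : ℝ) ≤ p := by exact_mod_cast hpq.1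
    have r3 : (p : ℝ) ≤ -q := by exact_mod_cast hpq.2
    push_cast at k1
    have : P.gA f 0 0 < P.gB f 0 0 := by
      by_contra hcon
      nlinarith
    nlinarith
  have hpq := corner_upper hA hin hq
  -- Convexity: `(-1, 1)` lies between the interior point `(k, 1)` and the active vertex `(0, 1)`,
  -- and differs from the latter.
  have hy : InIntr f P (-1) 1 := by
    intro v hv
    have a1 := hk v hv
    have a2 : cutVal f v (P.pt 0 1) ≤ 0 := hd.2 v hv
    rw [cutVal_affine] at a1 ⊢
    have r1 : (k : ℝ) ≤ -1 := by exact_mod_cast hk1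
    push_cast at *
    by_contra hcon
    nlinarith
  refine step_corner_aux (N := P.sub 0 0 1 0 (-1) 1 hdet) (x := -1) (y := 1) (a := p + q) (b := q)
    hA hin hc ?_ ?_ ?_ hy (by simp [P.pt_mem_carrier]) (by unfold rad dist01; omega)
  · rw [hpt, P.sub_pt]
    congr 1 <;> ring
  · rw [P.carrier_sub]; norm_num
  · intro v hv hne
    rw [P.carrier_sub] at hv
    rw [P.mem_carrier]
    norm_num at hv
    tauto

lemma step_corner_neg (hA : activeSet f P.carrier = {P.pt 0 0, P.pt 1 0, P.pt 0 1}) (hin : InIntr f P p q)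
    {k : ℤ} (hk : InIntr f P k (-1)) (hdet : |(1 : ℤ) * 1 - 0 * (-1)| = 1)
    (hc : Q.carrier = (P.sub 0 0 1 (-1) 0 1 hdet).carrier) (hpt : Q.pt p' q' = P.pt p q) :
    StepBound f P Q p q p' q' := by
  have hz : P.pt 0 0 ∈ activeSet f P.carrier := by rw [hA]; simp
  have hb : P.pt 1 0 ∈ activeSet f P.carrier := by rw [hA]; simp
  have hd : P.pt 0 1 ∈ activeSet f P.carrier := by rw [hA]; simp
  have hk1 := corner_lower hA hk le_rfl
  obtain rfl : k = 1 := by omega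
  obtain ⟨b1, -, -⟩ := active10.mp hb
  obtain ⟨d1, -, -⟩ := active01.mp hd
  have hq : q ≤ -1 := by
    by_contra hq
    have hq0 := row_ne_zero hz hb hin
    have hpq := corner_upper hA hin (by omega)
    have i1 := (inIntr_iff.mp hin).1
    have k1 := (inIntr_iff.mp hk).1
    have r2 : (p : ℝ) ≤ -1 := by exact_mod_cast hpq.1
    have r3 : (q : ℝ) ≤ -p := by exact_mod_cast hpq.2
    push_cast at k1
    nlinarith
  have hpq := corner_lower hA hin hq
  refine step_corner_aux (N := P.sub 0 0 1 (-1) 0 1 hdet) (x := 1) (y := -1) (a := p) (b := p + q)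
    hA hin hc ?_ ?_ ?_ hk (by simp [P.pt_mem_carrier]) (by unfold rad dist01; omega)
  · rw [hpt, P.sub_pt]
    congr 1 <;> ring
  · rw [P.carrier_sub]; norm_num
  · intro v hv hne
    rw [P.carrier_sub] at hv
    rw [P.mem_carrier]
    norm_num at hv
    tauto

end Flips

/-! ### An active edge with several interior points in the next row -/

section Flips2

variable {f : Plane → ℝ} {c : ℝ} {P Q N : UniSet} {p q p' q' : ℤ}

/-- Rows with two interior points contain two of them in the next set, so it keeps more than one
active vertex. -/
lemma not_single_of_two_intr (hf : LatticeConvex f c) {w : Lattice2}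
    (hw : w ∈ activeSet f N.carrier) (hwP : w ∈ P.carrier)
    (h0 : N.pt 0 0 ∈ P.carrier) (h1 : N.pt 1 0 ∈ P.carrier)
    (h2 : N.pt 0 1 ∉ P.carrier) (h3 : N.pt 1 1 ∉ P.carrier)
    (hx : ∀ v ∈ P.carrier, cutVal f v (N.pt 0 1) < 0)
    (hy : ∀ v ∈ P.carrier, cutVal f v (N.pt 1 1) < 0) : ∀ v, activeSet f N.carrier ≠ {v} := by
  rcases le_total (latVal f (N.pt 0 1)) (latVal f (N.pt 1 1)) with h | h
  · refine not_single_of (y := N.pt 0 1) hw ⟨by simp [N.pt_mem_carrier], ?_⟩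
      (by rintro rfl; exact h2 hwP)
    show ∀ v ∈ N.carrier, cutVal f v (N.pt 0 1) ≤ 0
    rw [forall_carrier]
    exact ⟨(hx _ h0).le, (hx _ h1).le, (cutVal_self f _).le, hf.cutVal_nonpos h⟩
  · refine not_single_of (y := N.pt 1 1) hw ⟨by simp [N.pt_mem_carrier], ?_⟩
      (by rintro rfl; exact h3 hwP)
    show ∀ v ∈ N.carrier, cutVal f v (N.pt 1 1) ≤ 0
    rw [forall_carrier]
    exact ⟨(hy _ h0).le, (hy _ h1).le, hf.cutVal_nonpos h, (cutVal_self f _).le⟩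

/-- The set reflected at an edge: the new set either is not of the type with potential
`3 * rad - 2`, or it has lost both endpoints of the edge. -/
lemma pot_reflect (hc : Q.carrier = N.carrier) {n : ℤ} (hn : 1 ≤ n) (hnp : n ≤ dist01 p)
    (hpt : Q.pt p' q' = N.pt p n) (hQ : Preprocessed f Q)
    (hinQ : InIntr f Q p' q') {w : Lattice2} (hw : w = N.pt 0 0 ∨ w = N.pt 1 0)
    (hwA : w ∈ activeSet f N.carrier) (hs : ∀ v, activeSet f N.carrier ≠ {v}) :
    pot f Q p' q' ≤ 3 * rad p n - 3 := by
  have hR := rad_relabel hc hpt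
  have hD := dist01_relabel hc hpt
  have hs' : activeSet f Q.carrier ≠ {Q.pt 0 0} := by rw [hc]; exact hs _
  by_cases hb : Q.pt 1 0 ∈ activeSet f Q.carrier
  swap
  · unfold pot
    rw [if_neg hs', if_neg hb]
    omega
  rcases pot_edge (p := p') (q := q') hb with ⟨h1, h2, -⟩ | ⟨-, h⟩
  swap
  · omega
  -- The value `-2` needs an active edge with the optimum beyond it. Among the edges parallel to the
  -- first column of `N` that is the top one, but then the shape excludes `w`, which lies on the
  -- bottom edge. For the other two edges the depth would be `dist01 p ≥ n`, exceeding the distance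
  -- `n - 1` along the edge.
  exfalso
  obtain ⟨i, j, hi, hj, ⟨hrel, e1, e2⟩ | ⟨hrel, e1, e2⟩⟩ := relabel_coords hc hpt
  · obtain rfl : j = 1 := by
      rcases hj with rfl | rfl
      · omega
      · rfl
    rw [← hc] at hwA
    rcases hQ.shape with h | h | ⟨h, -⟩ | h | ⟨h3, -, h4, h5⟩
    · exact hs' h
    · rw [h] at hwA
      simp only [Set.mem_insert_iff, Set.mem_singleton_iff, hrel] at hwA
      rcases hw with rfl | rfl <;> simp [N.pt_inj] at hwA
    · rw [h] at hb
      simp [Q.pt_inj] at hb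
    · have := corner_lower h hinQ h1
      unfold dist01 at h2
      omega
    · exact not_all_active h3 hb h4 h5 hinQ
  · unfold dist01 at *
    rcases hi with rfl | rfl <;> rcases hj with rfl | rfl <;> omega

/-- Minimality of `|k|` confines the optimum by `row_lower` or `row_upper`, so the shear by `m`
lowers `rad`, except for a plain reflection (`k = 0`, `i = -1`), where `rad` may stay the same and
`pot_reflect` provides the gain. -/
lemma step_row (hf : LatticeConvex f c)
    (hA : activeSet f P.carrier = {P.pt 0 0, P.pt 1 0}) {i k l m : ℤ} (hi : i = -1 ∨ i = 1)
    (hin : InIntr f P p q) (hk : InIntr f P k i) (hl : InIntr f P l i) (hkl : l ≠ k)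
    (hmin : ∀ l, InIntr f P l i → |k| ≤ |l|)
    (hm : (0 ≤ k ∧ m = k) ∨ (k ≤ -1 ∧ m = k - 1)) (hdet : |1 * i - m * 0| = 1)
    (hc : Q.carrier = (P.sub 0 0 1 0 m i hdet).carrier)
    (hpt : Q.pt p' q' = P.pt p q) (hQ : Preprocessed f Q)
    (hinQ : ∀ v ∈ Q.carrier, cutVal f v (P.pt p q) < 0) : StepBound f P Q p q p' q' := by
  have hz : P.pt 0 0 ∈ activeSet f P.carrier := by rw [hA]; simp
  have hb : P.pt 1 0 ∈ activeSet f P.carrier := by rw [hA]; simp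
  have hd := InIntr.not_of_not_active (f := f) (P := P) (x := 0) (y := 1)
    (by simp [P.pt_mem_carrier]) (by rw [hA]; simp [P.pt_inj])
  have he := InIntr.not_of_not_active (f := f) (P := P) (x := 1) (y := 1)
    (by simp [P.pt_mem_carrier]) (by rw [hA]; simp [P.pt_inj])
  -- The optimum is on the chosen side: an interior point opposite would leave only one point in row
  -- `i`.
  obtain ⟨n, hn, rfl⟩ : ∃ n, 1 ≤ n ∧ q = n * i := by
    have hq0 := row_ne_zero hz hb hin
    have hii : i * i = 1 := by rcases hi with rfl | rfl <;> norm_num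
    rcases lt_or_ge (q * i) 1 with h | h
    · exfalso
      have hne : q * i ≠ 0 := mul_ne_zero hq0 (by rintro rfl; omega)
      obtain ⟨k', hk'⟩ := exists_row_point (s := -i) (n := -(q * i)) (p := p) hz hb (by omega)
        (by
          have : -(q * i) * -i = q := by linear_combination q * hii
          rwa [this])
      have e1 := opposite_rows hz hb hk hk'
      have e2 := opposite_rows hz hb hl hk'
      omega
    · exact ⟨q * i, h, by linear_combination (-q) * hii⟩
  set N := P.sub 0 0 1 0 m i hdet with hN
  have hNpt : ∀ x y, N.pt x y = P.pt (x + y * m) (y * i) := by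
    intro x y
    rw [hN, P.sub_pt]
    congr 1 <;> ring
  have hNzs : N.pt (p - n * m) n = P.pt p (n * i) := by
    rw [hNpt]
    congr 1
    ring
  have hpt' : Q.pt p' q' = N.pt (p - n * m) n := by rw [hpt, hNzs]
  have hlow : 1 ≤ k → n * (k - 1) + 1 ≤ p := by
    intro h
    refine row_lower hz hn hin hk (fun h' => ?_)
    have := hmin _ h'
    rw [abs_of_nonneg (by omega), abs_of_nonneg (by omega)] at this
    omega
  have hupp : k ≤ -1 → p ≤ n * k := by
    intro h
    refine row_upper hb hn hin hk (fun h' => ?_)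
    have := hmin _ h'
    rw [abs_of_neg (by omega), abs_of_nonpos (by omega)] at this
    omega
  have hnext : 1 ≤ k → InIntr f P (k + 1) i := by
    intro h
    rcases lt_or_gt_of_ne hkl with h' | h'
    · exfalso
      have := hmin _ (hl.between hk (by omega : l ≤ k - 1) (by omega))
      rw [abs_of_nonneg (by omega), abs_of_nonneg (by omega)] at this
      omega
    · exact hk.between hl (by omega) (by omega)
  have hprev : k ≤ -1 → InIntr f P (k - 1) i := by
    intro h
    rcases lt_or_gt_of_ne hkl with h' | h'
    · exact hl.between hk (by omega) (by omega)
    · exfalso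
      have := hmin _ (hk.between hl (by omega : k ≤ k + 1) (by omega))
      rw [abs_of_neg (by omega), abs_of_nonpos (by omega)] at this
      omega
  have hi1 : i = 1 → k ≠ 0 ∧ k ≠ 1 := by
    rintro rfl
    exact ⟨by rintro rfl; exact hd hk, by rintro rfl; exact he hk⟩
  have hR : rad (p - n * m) n ≤ rad p (n * i) - 1 ∨
      (k = 0 ∧ n * i ≤ -1 ∧ -(n * i) ≤ dist01 p ∧ rad (p - n * m) n ≤ rad p (n * i)) := by
    rcases lt_trichotomy k 0 with h | h | h
    · left
      have h1 := hupp (by omega)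
      obtain ⟨-, rfl⟩ : k ≤ -1 ∧ m = k - 1 := by omega
      have h2 : n * k ≤ -n := by nlinarith
      have h3 : n * (k - 1) = n * k - n := by ring
      unfold rad dist01
      rcases hi with rfl | rfl <;> omega
    · obtain ⟨-, rfl⟩ : 0 ≤ k ∧ m = k := by omega
      have : i = -1 := by
        rcases hi with h' | h'
        · exact h'
        · exact absurd h (hi1 h').1
      subst this h
      unfold rad dist01
      omega
    · left
      have h1 := hlow h
      obtain ⟨-, rfl⟩ : 0 ≤ k ∧ m = k := by omega
      have h3 : n * (m - 1) = n * m - n := by ring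
      rcases lt_or_ge m 2 with h2 | h2
      · obtain rfl : m = 1 := by omega
        have : i = -1 := by
          rcases hi with h' | h'
          · exact h'
          · exact absurd rfl (hi1 h').2
        subst this
        unfold rad dist01
        omega
      · have : n * 2 ≤ n * m := by nlinarith
        unfold rad dist01
        rcases hi with rfl | rfl <;> omega
  have hP := pot_edge (p := p) (q := n * i) hb
  -- The plain reflection may raise the potential from `3 * rad - 2` to `3 * rad + 3`, which
  -- accounts for the five in `StepBound`.
  refine ⟨by have := pot_le (f := f) hc hpt'; omega, fun w hw hwA => ?_⟩
  have hwP := hw.mem_activeSet hf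
  rw [hA] at hwP
  simp only [Set.mem_insert_iff, Set.mem_singleton_iff] at hwP
  have hi0 : i ≠ 0 := by omega
  have hN0 : N.pt 0 0 = P.pt 0 0 := by rw [hNpt]; norm_num
  have hN1 : N.pt 1 0 = P.pt 1 0 := by rw [hNpt]; norm_num
  have hwN := hwA
  rw [hc] at hwN
  have two : InIntr f P m i → InIntr f P (m + 1) i →
      (k = 0 → ¬ InIntr f P 0 1 ∧ i = -1) → ∀ v, activeSet f N.carrier ≠ {v} := by
    intro hx hy hk0
    have hout : ∀ t, InIntr f P t i → P.pt t i ∉ P.carrier := by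
      intro t ht hmem
      rw [P.pt_mem_carrier] at hmem
      obtain ⟨rfl | rfl, hi'⟩ := hmem
      · obtain rfl : i = 1 := by omega
        exact hd ht
      · obtain rfl : i = 1 := by omega
        exact he ht
    refine not_single_of_two_intr (P := P) hf hwN hw.1 (by rw [hN0]; exact hz.1)
      (by rw [hN1]; exact hb.1) ?_ ?_ ?_ ?_
    · rw [hNpt]; simpa using hout m hx
    · rw [hNpt]; simpa [add_comm] using hout (m + 1) hy
    · rw [hNpt, zero_add, one_mul, one_mul]; exact hx
    · rw [hNpt, one_mul, one_mul, add_comm]; exact hy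
  have hns : ∀ v, activeSet f N.carrier ≠ {v} := by
    rcases lt_trichotomy k 0 with h | h | h
    · obtain ⟨-, rfl⟩ : k ≤ -1 ∧ m = k - 1 := by omega
      exact two (hprev (by omega)) (by simpa using hk) (by omega)
    · obtain ⟨-, rfl⟩ : 0 ≤ k ∧ m = k := by omega
      have : i = -1 := by
        rcases hi with h' | h'
        · exact h'
        · exact absurd h (hi1 h').1
      subst this h
      -- For `k = 0` the second interior point of the row may be `(-1, -1)`, outside the new cell,
      -- so a single active vertex is refuted at each endpoint of the edge separately.
      intro v hv
      have hwN' := single_eq hwN hv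
      rcases hwP with rfl | rfl
      · rcases neighbour_cut (P := N) hf (by rw [hwN', hN0]; simp) with h | h
        · rw [gA_eq_cutVal, hN0, hN1] at h
          exact absurd h (not_lt.mpr (hb.2 _ hz.1))
        · rw [gB_eq_cutVal, hN0, hNpt] at h
          norm_num at h
          exact absurd h (not_lt.mpr (hk _ hz.1).le)
      · set M := N.sub 1 0 (-1) 0 0 1 (by norm_num) with hM
        have hMpt : ∀ x y, M.pt x y = N.pt (1 - x) y := by
          intro x y
          rw [hM, N.sub_pt]
          congr 1 <;> ring
        have hMc : M.carrier = N.carrier := by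
          apply sub_carrier_of_coords N M 1 0 (by simp) (by simp)
          left
          intro x y
          rw [hMpt]
          congr 1 <;> ring
        have hM0 : M.pt 0 0 = P.pt 1 0 := by rw [hMpt]; norm_num [hN1]
        have hM1 : M.pt 1 0 = P.pt 0 0 := by rw [hMpt]; norm_num [hN0]
        have hMzs : M.pt (1 - p) n = P.pt p (n * -1) := by
          rw [← hNzs, hMpt]
          congr 1
          ring
        have := single_flip_side (P := M) (p := 1 - p) (q := n) hf
          (by rw [hMc, hwN', hM0])
          (by rw [gA_eq_cutVal, hM0, hM1]; exact hz.2 _ hb.1)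
          (fun v hv => by rw [hMzs]; exact hinQ v (by rwa [hc, ← hMc]))
        omega
    · obtain ⟨-, rfl⟩ : 0 ≤ k ∧ m = k := by omega
      exact two hk (hnext (by omega)) (by omega)
  have hpot := pot_le_of_not_single (f := f) hc hpt' hns
  rcases hR with hR | ⟨h0, h1, h2, h3⟩
  · omega
  · obtain ⟨-, rfl⟩ : 0 ≤ k ∧ m = k := by omega
    subst h0
    have hii : i = -1 := by
      rcases hi with h' | h'
      · exact h'
      · exact absurd rfl (hi1 h').1
    subst hii
    have hp0 : p - n * 0 = p := by ring
    rw [hp0] at hpt' h3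
    have := pot_reflect hc hn (by omega) hpt' hQ (fun v hv => by rw [hpt]; exact hinQ v hv)
      (by rw [hN0, hN1]; exact hwP) hwN hns
    omega

/-! ### Two opposite active vertices -/

/-- Only the half-planes of the two active vertices are needed: the signs of their derivatives along
`u¹` and along the diagonal leave two opposite wedges. -/
lemma diag_region (hA : activeSet f P.carrier = {P.pt 0 0, P.pt 1 1}) (h1 : 0 < P.gA f 0 0)
    (h2 : P.gA f 1 1 < 0) (hin : InIntr f P p q) :
    (2 ≤ p ∧ 1 ≤ q ∧ q ≤ p - 1) ∨ (p ≤ -1 ∧ p + 1 ≤ q ∧ q ≤ 0) := by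
  obtain ⟨-, -, z3⟩ := active00.mp (by rw [hA]; simp : P.pt 0 0 ∈ activeSet f P.carrier)
  obtain ⟨e1, -, -⟩ := active11.mp (by rw [hA]; simp : P.pt 1 1 ∈ activeSet f P.carrier)
  obtain ⟨i1, -, -, i4⟩ := inIntr_iff.mp hin
  rcases lt_or_ge p 1 with h | h
  · have hp : (p : ℝ) ≤ 0 := by exact_mod_cast (by omega : p ≤ 0)
    have hq1 : (q : ℝ) < 1 := by
      by_contra hcon
      nlinarith
    have hpq : (p : ℝ) < q := by
      by_contra hcon
      nlinarith
    have hq1' : q < 1 := by exact_mod_cast hq1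
    have hpq' : p < q := by exact_mod_cast hpq
    omega
  · have hp : (1 : ℝ) ≤ p := by exact_mod_cast h
    have hq1 : (0 : ℝ) < q := by
      by_contra hcon
      nlinarith
    have hpq : (q : ℝ) < p := by
      by_contra hcon
      nlinarith
    have hq1' : 0 < q := by exact_mod_cast hq1
    have hpq' : q < p := by exact_mod_cast hpq
    omega

lemma pot_diag (hA : activeSet f P.carrier = {P.pt 0 0, P.pt 1 1}) :
    pot f P p q = 3 * rad p q - 3 := by
  have h1 : activeSet f P.carrier ≠ {P.pt 0 0} := by
    intro h
    have : P.pt 1 1 ∈ activeSet f P.carrier := by rw [hA]; simp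
    rw [h] at this
    simp [P.pt_inj] at this
  have h2 : P.pt 1 0 ∉ activeSet f P.carrier := by rw [hA]; simp [P.pt_inj]
  unfold pot
  rw [if_neg h1, if_neg h2]

/-- In the new cell the optimum is `(p - q, q)`, which lowers `rad` except on the ray `q = 0`, `p ≤
-1`. On that ray the new cell is connected, because under the other two conditions a vertex would
cut the optimum. -/
lemma step_diag_aux (hf : LatticeConvex f c)
    (hA : activeSet f P.carrier = {P.pt 0 0, P.pt 1 1}) (h1 : 0 < P.gA f 0 0)
    (h2 : P.gA f 1 1 < 0) (hin : InIntr f P p q) (hdet : |(1 : ℤ) * 1 - 1 * 0| = 1)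
    (hcond : IsConnectedCell f (P.sub 0 0 1 0 1 1 hdet).carrier ∨
      activeSet f (P.sub 0 0 1 0 1 1 hdet).carrier = {P.pt 2 1} ∨
      (0 < cutVal f (P.pt 1 1) (P.pt (-1) 0) ∧ 0 < cutVal f (P.pt (-1) 0) (P.pt 0 0)))
    (hc : Q.carrier = (P.sub 0 0 1 0 1 1 hdet).carrier)
    (hpt : Q.pt p' q' = P.pt p q) (hQ : Preprocessed f Q)
    (hinQ : ∀ v ∈ Q.carrier, cutVal f v (P.pt p q) < 0) :
    pot f Q p' q' ≤ 3 * rad p q + 2 ∧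
    ∀ w, IsMinOf f P.carrier w → w ∈ activeSet f Q.carrier → pot f Q p' q' ≤ 3 * rad p q - 4 := by
  have hreg := diag_region hA h1 h2 hin
  have hz : P.pt 0 0 ∈ activeSet f P.carrier := by rw [hA]; simp
  have he : P.pt 1 1 ∈ activeSet f P.carrier := by rw [hA]; simp
  obtain ⟨z1, z2, z3⟩ := active00.mp hz
  obtain ⟨e1, e2, e3⟩ := active11.mp he
  set N := P.sub 0 0 1 0 1 1 hdet with hN
  have hNpt : ∀ x y, N.pt x y = P.pt (x + y) y := by
    intro x y
    rw [hN, P.sub_pt]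
    congr 1 <;> ring
  have hpt' : Q.pt p' q' = N.pt (p - q) q := by
    rw [hpt, hNpt]
    congr 1
    ring
  by_cases hq : p ≤ -1 ∧ q = 0
  · obtain ⟨hp, rfl⟩ := hq
    have hconn : IsConnectedCell f N.carrier := by
      rcases hcond with h | h | ⟨h3, h4⟩
      · exact h
      · exfalso
        have hp' : (p : ℝ) ≤ -1 := by exact_mod_cast hp
        -- Both lost vertices can only be cut by `pt 2 1`, which then cuts the whole ray.
        have hzN : P.pt 0 0 ∉ activeSet f N.carrier := by rw [h]; simp [P.pt_inj]
        have heN : P.pt 1 1 ∉ activeSet f N.carrier := by rw [h]; simp [P.pt_inj]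
        have hz' := exists_cut (by rw [N.mem_carrier]; simp [hNpt, P.pt_inj]) hzN
        have he' := exists_cut (by rw [N.mem_carrier]; simp [hNpt, P.pt_inj]) heN
        rw [exists_carrier] at hz' he'
        simp only [hNpt, P.cutVal_pt] at hz' he'
        have ht := hinQ (P.pt 2 1) (by rw [hc, N.mem_carrier]; simp [hNpt, P.pt_inj])
        rw [P.cutVal_pt] at ht
        norm_num at hz' he' ht
        have t1 : P.gA f 2 1 < 0 := by
          rcases he' with h | h | h
          · linarith
          · linarith
          · exact h
        have t2 : 2 * P.gA f 2 1 + P.gB f 2 1 < 0 := by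
          rcases hz' with h | h | h
          · linarith
          · linarith
          · linarith
        nlinarith
      · exfalso
        have hp' : (p : ℝ) ≤ -1 := by exact_mod_cast hp
        obtain ⟨i1, -, -, i4⟩ := inIntr_iff.mp hin
        rw [P.cutVal_pt] at h3
        push_cast at h3 i4
        nlinarith
    have := pot_connected hc hpt' hQ hconn (Or.inr (by unfold dist01; omega))
    have hR : rad (p - 0) 0 = rad p 0 := by simp
    exact ⟨by omega, fun _ _ _ => by omega⟩
  · have hR : rad (p - q) q ≤ rad p q - 1 := by
      unfold rad dist01
      omega
    refine ⟨by have := pot_le (f := f) hc hpt'; omega, fun w hw hwA => ?_⟩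
    rw [hc] at hwA
    have hns : ∀ v, activeSet f N.carrier ≠ {v} := by
      intro v hv
      have hwN := single_eq hwA hv
      have hwP := hw.mem_activeSet hf
      rw [hA] at hwP
      simp only [Set.mem_insert_iff, Set.mem_singleton_iff] at hwP
      rcases hwP with rfl | rfl
      · rcases hcond with ⟨M, hM, m1, m2⟩ | h | ⟨h3, h4⟩
        · rw [hwN, Set.mem_singleton_iff] at m1 m2
          rw [← M.pt_zero] at m1
          rw [← M.pt_one_zero] at m2
          have := m1.trans m2.symm
          simp [M.pt_inj] at this
        · rw [h] at hwN
          simp [P.pt_inj] at hwN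
        -- The two cuts make `f` smaller at `pt 1 1` than at `pt 0 0`, so the latter is not a
        -- minimiser.
        · linarith [hf.drop h3, hf.drop h4, hf.1, hw.2 _ he.1]
      · set M := N.sub 0 1 1 0 0 (-1) (by norm_num) with hM
        have hMpt : ∀ x y, M.pt x y = N.pt x (1 - y) := by
          intro x y
          rw [hM, N.sub_pt]
          congr 1 <;> ring
        have hMc : M.carrier = N.carrier := by
          apply sub_carrier_of_coords N M 0 1 (by simp) (by simp)
          left
          intro x y
          rw [hMpt]
          congr 1 <;> ring
        rcases neighbour_cut (P := M) hf (by rw [hMc, hwN, hMpt, hNpt]; simp) with h | h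
        · rw [gA_eq_cutVal, hMpt, hMpt, hNpt, hNpt, P.cutVal_pt] at h
          norm_num at h
          linarith
        · rw [gB_eq_cutVal, hMpt, hMpt, hNpt, hNpt, P.cutVal_pt] at h
          norm_num at h
          linarith
    have := pot_le_of_not_single (f := f) hc hpt' hns
    omega

lemma step_diag_first (hf : LatticeConvex f c)
    (hA : activeSet f P.carrier = {P.pt 0 0, P.pt 1 1}) (h1 : 0 < P.gA f 0 0)
    (h2 : P.gA f 1 1 < 0) (hin : InIntr f P p q) (hdet : |(1 : ℤ) * 1 - 1 * 0| = 1)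
    (hcond : IsConnectedCell f (P.sub 0 0 1 0 1 1 hdet).carrier ∨
      activeSet f (P.sub 0 0 1 0 1 1 hdet).carrier = {P.pt 2 1} ∨
      (0 < cutVal f (P.pt 1 1) (P.pt (-1) 0) ∧ 0 < cutVal f (P.pt (-1) 0) (P.pt 0 0)))
    (hc : Q.carrier = (P.sub 0 0 1 0 1 1 hdet).carrier)
    (hpt : Q.pt p' q' = P.pt p q) (hQ : Preprocessed f Q)
    (hinQ : ∀ v ∈ Q.carrier, cutVal f v (P.pt p q) < 0) : StepBound f P Q p q p' q' := by
  obtain ⟨a, b⟩ := step_diag_aux hf hA h1 h2 hin hdet hcond hc hpt hQ hinQ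
  have := pot_diag (p := p) (q := q) hA
  exact ⟨by omega, fun w hw hwA => by have := b w hw hwA; omega⟩

/-- The half-turn about the centre of the cell exchanges the two flips and their conditions. -/
lemma step_diag_second (hf : LatticeConvex f c)
    (hA : activeSet f P.carrier = {P.pt 0 0, P.pt 1 1}) (h1 : 0 < P.gA f 0 0)
    (h2 : P.gA f 1 1 < 0) (hin : InIntr f P p q) (hdet : |(-1 : ℤ) * 1 - 1 * 0| = 1)
    (hcond : IsConnectedCell f (P.sub 0 0 (-1) 0 1 1 hdet).carrier ∨
      activeSet f (P.sub 0 0 (-1) 0 1 1 hdet).carrier = {P.pt (-1) 0} ∨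
      (0 < cutVal f (P.pt 0 0) (P.pt 2 1) ∧ 0 < cutVal f (P.pt 2 1) (P.pt 1 1)))
    (hc : Q.carrier = (P.sub 0 0 (-1) 0 1 1 hdet).carrier)
    (hpt : Q.pt p' q' = P.pt p q) (hQ : Preprocessed f Q)
    (hinQ : ∀ v ∈ Q.carrier, cutVal f v (P.pt p q) < 0) : StepBound f P Q p q p' q' := by
  set M := P.sub 1 1 (-1) 0 0 (-1) (by norm_num) with hM
  have hMpt : ∀ x y, M.pt x y = P.pt (1 - x) (1 - y) := by
    intro x y
    rw [hM, P.sub_pt]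
    congr 1 <;> ring
  have hMc : M.carrier = P.carrier := by
    apply sub_carrier_of_coords P M 1 1 (by simp) (by simp)
    left
    intro x y
    rw [hMpt]
    congr 1 <;> ring
  have hMzs : M.pt (1 - p) (1 - q) = P.pt p q := by
    rw [hMpt]
    congr 1 <;> ring
  have hsub : (M.sub 0 0 1 0 1 1 (by norm_num)).carrier = (P.sub 0 0 (-1) 0 1 1 hdet).carrier := by
    ext w
    rw [M.carrier_sub, P.carrier_sub]
    simp only [hMpt]
    norm_num
    tauto
  have hMA : activeSet f M.carrier = {M.pt 0 0, M.pt 1 1} := by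
    rw [hMc, hA, hMpt, hMpt]
    norm_num
    exact Set.pair_comm _ _
  have hg : M.gA f 0 0 = - P.gA f 1 1 := by
    rw [gA_eq_cutVal, hMpt, hMpt, P.cutVal_pt]
    norm_num
  have hg' : M.gA f 1 1 = - P.gA f 0 0 := by
    have : M.gA f 1 1 = - cutVal f (M.pt 1 1) (M.pt 0 1) := by rw [M.cutVal_pt]; norm_num
    rw [this, hMpt, hMpt, P.cutVal_pt]
    norm_num
  obtain ⟨a, b⟩ := step_diag_aux (P := M) (p := 1 - p) (q := 1 - q) hf hMA
    (by rw [hg]; linarith) (by rw [hg']; linarith)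
    (fun v hv => by rw [hMzs]; exact hin v (by rwa [← hMc])) (by norm_num)
    (by
      rw [hsub]
      simp only [hMpt]
      norm_num
      exact hcond)
    (hc.trans hsub.symm) (hpt.trans hMzs.symm) hQ
    (fun v hv => by rw [hMzs]; exact hinQ v hv)
  have hP := pot_diag (p := p) (q := q) hA
  have hR : rad (1 - p) (1 - q) = rad p q := by
    unfold rad dist01
    omega
  rw [hMc] at b
  exact ⟨by omega, fun w hw hwA => by have := b w hw hwA; omega⟩

/-- The optimum becomes `(2 * q - p, q)`, which lowers `rad` in both wedges. If only `w` survives,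
`single_flip_side` places the optimum beyond it, and in the reflected cell `rad` is lower by two
than at the start. -/
lemma step_diag_third (hf : LatticeConvex f c)
    (hA : activeSet f P.carrier = {P.pt 0 0, P.pt 1 1}) (h1 : 0 < P.gA f 0 0)
    (h2 : P.gA f 1 1 < 0) (hin : InIntr f P p q) (hdet : |(-1 : ℤ) * 1 - 2 * 0| = 1)
    (hc : Q.carrier = (P.sub 0 0 (-1) 0 2 1 hdet).carrier)
    (hpt : Q.pt p' q' = P.pt p q) (hQ : Preprocessed f Q)
    (hinQ : ∀ v ∈ Q.carrier, cutVal f v (P.pt p q) < 0) : StepBound f P Q p q p' q' := by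
  have hreg := diag_region hA h1 h2 hin
  have hP := pot_diag (p := p) (q := q) hA
  set N := P.sub 0 0 (-1) 0 2 1 hdet with hN
  have hNpt : ∀ x y, N.pt x y = P.pt (2 * y - x) y := by
    intro x y
    rw [hN, P.sub_pt]
    congr 1 <;> ring
  have hNzs : N.pt (2 * q - p) q = P.pt p q := by
    rw [hNpt]
    congr 1
    ring
  have hpt' : Q.pt p' q' = N.pt (2 * q - p) q := by rw [hpt, hNzs]
  have hR : rad (2 * q - p) q ≤ rad p q - 1 := by
    unfold rad dist01
    omega
  refine ⟨by have := pot_le (f := f) hc hpt'; omega, fun w hw hwA => ?_⟩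
  rw [hc] at hwA
  by_cases hns : ∀ v, activeSet f N.carrier ≠ {v}
  · have := pot_le_of_not_single (f := f) hc hpt' hns
    omega
  push Not at hns
  obtain ⟨v, hv⟩ := hns
  have hwN := single_eq hwA hv
  have hwP := hw.mem_activeSet hf
  rw [hA] at hwP
  simp only [Set.mem_insert_iff, Set.mem_singleton_iff] at hwP
  rcases hwP with rfl | rfl
  · have h0 : N.pt 0 0 = P.pt 0 0 := by rw [hNpt]; norm_num
    rw [← h0] at hwN
    have hg : N.gA f 0 0 < 0 := by
      rw [gA_eq_cutVal, hNpt, hNpt, P.cutVal_pt]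
      norm_num
      exact h1
    have hside := single_flip_side (p := 2 * q - p) (q := q) hf hwN hg.le
      (fun v hv => by rw [hNzs]; exact hinQ v (by rwa [hc]))
    have hg2 := (neighbour_cut (P := N) hf (by rw [hwN]; simp)).resolve_left (not_lt.mpr hg.le)
    rw [pot_single hc hpt' hQ hwN, hP]
    unfold descentSign
    rw [if_pos hg.le, if_neg (not_le.mpr hg2)]
    unfold rad dist01
    omega
  · set M := N.sub 1 1 (-1) 0 0 (-1) (by norm_num) with hM
    have hMpt : ∀ x y, M.pt x y = N.pt (1 - x) (1 - y) := by
      intro x y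
      rw [hM, N.sub_pt]
      congr 1 <;> ring
    have hMc : M.carrier = N.carrier := by
      apply sub_carrier_of_coords N M 1 1 (by simp) (by simp)
      left
      intro x y
      rw [hMpt]
      congr 1 <;> ring
    have h0 : M.pt 0 0 = P.pt 1 1 := by rw [hMpt, hNpt]; norm_num
    have hMzs : M.pt (1 - (2 * q - p)) (1 - q) = P.pt p q := by
      rw [← hNzs, hMpt]
      congr 1 <;> ring
    rw [← h0, ← hMc] at hwN
    have hg : M.gA f 0 0 < 0 := by
      rw [gA_eq_cutVal, hMpt, hMpt, hNpt, hNpt, P.cutVal_pt]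
      norm_num
      exact h2
    have hside := single_flip_side (p := 1 - (2 * q - p)) (q := 1 - q) hf hwN hg.le
      (fun v hv => by rw [hMzs]; exact hinQ v (by rwa [hc, ← hMc]))
    have hg2 := (neighbour_cut (P := M) hf (by rw [hwN]; simp)).resolve_left (not_lt.mpr hg.le)
    rw [pot_single (hc.trans hMc.symm) (hpt.trans hMzs.symm) hQ hwN, hP]
    unfold descentSign
    rw [if_pos hg.le, if_neg (not_le.mpr hg2)]
    unfold rad dist01
    omega

end Flips2

/-! ### Updates -/

section Updates

variable {f : Plane → ℝ} {c : ℝ} {P Q : UniSet} {p q p' q' : ℤ}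

lemma latticeCell_eq_sub (P : UniSet) {v w : Lattice2} (a b k l : ℤ) (h : |a * l - k * b| = 1)
    (hv : v = a • P.u1 + b • P.u2) (hw : w = k • P.u1 + l • P.u2) :
    latticeCell P.z (ofCols v w) = (P.sub 0 0 a b k l h).carrier := by
  subst hv hw
  unfold UniSet.carrier UniSet.sub
  simp [P.pt_zero]

lemma mem_latticeH {i : ℤ} {w : Lattice2} :
    w ∈ latticeH f P i ↔ ∃ l, w = P.pt l i ∧ InIntr f P l i := by
  constructor
  · rintro ⟨hin, k, hk⟩
    obtain ⟨x, y, rfl⟩ := P.exists_pt w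
    have e : ∀ t : Fin 2, ((x : ℝ) - k) * P.u1 t + ((y : ℝ) - i) * P.u2 t = 0 := by
      intro t
      have := congrArg (fun v : Plane => v t) hk
      simp [emb, P.pt_apply] at this
      linarith
    have hdet : ((y : ℝ) - i) * ((P.u1 0 * P.u2 1 - P.u2 0 * P.u1 1 : ℤ) : ℝ) = 0 := by
      push_cast
      linear_combination P.u1 0 * e 1 - P.u1 1 * e 0
    have hy : y = i := by
      rcases P.det_cases with h | h <;> rw [h] at hdet <;> push_cast at hdet
      · have : (y : ℝ) = i := by linarith
        exact_mod_cast this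
      · have : (y : ℝ) = i := by linarith
        exact_mod_cast this
    subst hy
    exact ⟨x, rfl, hin⟩
  · rintro ⟨l, rfl, h⟩
    refine ⟨h, l, ?_⟩
    simp only [UniSet.pt, emb_add, emb_smul]

lemma pt_mem_latticeH {i k : ℤ} :
    P.z + k • P.u1 + i • P.u2 ∈ latticeH f P i ↔ InIntr f P k i := by
  rw [mem_latticeH]
  constructor
  · rintro ⟨l, hl, h⟩
    obtain rfl : k = l := (P.pt_inj.mp hl).1
    exact h
  · exact fun h => ⟨k, rfl, h⟩

lemma unique_of_encard {i k : ℤ} (hH : (latticeH f P i).encard = 1) (hk : InIntr f P k i) :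
    ∀ l, InIntr f P l i → l = k := by
  intro l hl
  obtain ⟨x, hx⟩ := Set.encard_eq_one.mp hH
  have h1 : P.pt k i ∈ latticeH f P i := mem_latticeH.mpr ⟨k, rfl, hk⟩
  have h2 : P.pt l i ∈ latticeH f P i := mem_latticeH.mpr ⟨l, rfl, hl⟩
  rw [hx, Set.mem_singleton_iff] at h1 h2
  exact (P.pt_inj.mp (h2.trans h1.symm)).1

lemma exists_ne_of_encard {i : ℤ} (k : ℤ) (hH : 2 ≤ (latticeH f P i).encard) :
    ∃ l, InIntr f P l i ∧ l ≠ k := by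
  obtain ⟨a, b, ha, hb, hab⟩ :=
    Set.one_lt_encard_iff.mp (lt_of_lt_of_le (by norm_num : (1 : ℕ∞) < 2) hH)
  obtain ⟨x, rfl, hx⟩ := mem_latticeH.mp ha
  obtain ⟨y, rfl, hy⟩ := mem_latticeH.mp hb
  by_cases h : x = k
  · refine ⟨y, hy, ?_⟩
    rintro rfl
    exact hab (by rw [h])
  · exact ⟨x, hx, h⟩

lemma exists_of_encard {i : ℤ} (hH : 1 ≤ (latticeH f P i).encard) : ∃ l, InIntr f P l i := by
  obtain ⟨w, hw⟩ := Set.one_le_encard_iff_nonempty.mp hH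
  obtain ⟨x, -, hx⟩ := mem_latticeH.mp hw
  exact ⟨x, hx⟩

lemma diag_cuts (hP : Preprocessed f P) (hA : activeSet f P.carrier = {P.pt 0 0, P.pt 1 1}) :
    0 < P.gA f 0 0 ∧ P.gA f 1 1 < 0 := by
  rcases hP.shape with h | h | ⟨-, h⟩ | h | ⟨-, h, -⟩
  · have : P.pt 1 1 ∈ activeSet f P.carrier := by rw [hA]; simp
    rw [h] at this
    simp [P.pt_inj] at this
  · have : P.pt 1 1 ∈ activeSet f P.carrier := by rw [hA]; simp
    rw [h] at this
    simp [P.pt_inj] at this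
  · exact h
  · have : P.pt 1 1 ∈ activeSet f P.carrier := by rw [hA]; simp
    rw [h] at this
    simp [P.pt_inj] at this
  · rw [hA] at h
    simp [P.pt_inj] at h

lemma det_row {i : ℤ} (k : ℤ) (hi : i = -1 ∨ i = 1) : |1 * i - k * 0| = 1 := by
  rcases hi with rfl | rfl <;> simp

lemma det_pair {i : ℤ} (k : ℤ) (hi : i = -1 ∨ i = 1) : |k * (-i) - (1 - k) * i| = 1 := by
  have : k * (-i) - (1 - k) * i = -i := by ring
  rw [this]
  rcases hi with rfl | rfl <;> simp

lemma flipSign_eq_gA (f : Plane → ℝ) (P : UniSet) :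
    flipSign f P.z P.u1 = descentSign (P.gA f 0 0) := by
  unfold flipSign descentSign UniSet.gA
  rw [P.pt_zero]

lemma flipSign_eq_gB (f : Plane → ℝ) (P : UniSet) :
    flipSign f P.z P.u2 = descentSign (P.gB f 0 0) := by
  unfold flipSign descentSign UniSet.gB
  rw [P.pt_zero]

lemma det_signs (s t : ℝ) : |descentSign s * descentSign t - 0 * 0| = 1 := by
  rcases descentSign_cases s with ⟨h, -⟩ | ⟨h, -⟩ <;>
    rcases descentSign_cases t with ⟨h', -⟩ | ⟨h', -⟩ <;> rw [h, h'] <;> norm_num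

lemma UniSet.pt_two_one (P : UniSet) : P.pt 2 1 = P.z + (2 : ℤ) • P.u1 + P.u2 := by
  simp [UniSet.pt]

lemma UniSet.pt_neg_one_zero (P : UniSet) : P.pt (-1) 0 = P.z - P.u1 := by
  simp [UniSet.pt, sub_eq_add_neg]

/-- The flipped matrix spans a unimodular set that keeps all active vertices. -/
lemma FlipTo.spec {V : Matrix (Fin 2) (Fin 2) ℤ} (hV : FlipTo f P V) :
    (∃ N : UniSet, N.carrier = latticeCell P.z V) ∧
      activeSet f P.carrier ⊆ latticeCell P.z V := by
  have key : ∀ {v w : Lattice2} (a b k l : ℤ) (h : |a * l - k * b| = 1)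
      (_ : v = a • P.u1 + b • P.u2) (_ : w = k • P.u1 + l • P.u2)
      (_ : ∀ x ∈ activeSet f P.carrier, x = P.pt 0 0 ∨ x = P.pt (0 + a) (0 + b) ∨
        x = P.pt (0 + k) (0 + l) ∨ x = P.pt (0 + a + k) (0 + b + l)),
      (∃ N : UniSet, N.carrier = latticeCell P.z (ofCols v w)) ∧
        activeSet f P.carrier ⊆ latticeCell P.z (ofCols v w) := by
    intro v w a b k l h hv hw hx
    rw [latticeCell_eq_sub P a b k l h hv hw]
    exact ⟨⟨_, rfl⟩, fun x hxA => (P.carrier_sub 0 0 a b k l h).mpr (hx x hxA)⟩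
  cases hV with
  | case1 h =>
    refine key _ 0 0 _ (det_signs (P.gA f 0 0) (P.gB f 0 0)) ?_ ?_ ?_
    · rw [flipSign_eq_gA]; module
    · rw [flipSign_eq_gB]; module
    · rw [h, ← P.pt_zero]; simp
  | case2a h hA =>
    refine key 1 0 1 1 (by norm_num) (by module) (by module) ?_
    rw [h, ← P.pt_one_one, ← P.pt_zero]; simp
  | case2b h hA hB =>
    refine key (-1) 0 1 1 (by norm_num) (by module) (by module) ?_
    rw [h, ← P.pt_one_one, ← P.pt_zero]; simp
  | case2c h hA hB =>
    refine key (-1) 0 2 1 (by norm_num) (by module) (by module) ?_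
    rw [h, ← P.pt_one_one, ← P.pt_zero]; simp
  | case3 i k hi h hH hk =>
    refine key k i (1 - k) (-i) (det_pair k hi) rfl (by module) ?_
    rw [h, ← P.pt_one_zero, ← P.pt_zero]; simp
  | case4pos i k hi h hH hk hmin hs =>
    refine key 1 0 k i (det_row k hi) (by module) rfl ?_
    rw [h, ← P.pt_one_zero, ← P.pt_zero]; simp
  | case4neg i k hi h hH hk hmin hs =>
    refine key 1 0 (k - 1) i (det_row (k - 1) hi) (by module) rfl ?_
    rw [h, ← P.pt_one_zero, ← P.pt_zero]; simp
  | case5pos h hH =>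
    refine key 1 0 (-1) 1 (by norm_num) (by module) (by module) ?_
    rw [h, ← P.pt_one_zero, ← P.pt_zero_one, ← P.pt_zero]; simp
  | case5neg h hH =>
    refine key 1 (-1) 0 1 (by norm_num) (by module) (by module) ?_
    rw [h, ← P.pt_one_zero, ← P.pt_zero_one, ← P.pt_zero]; simp

lemma FlipTo.stepBound (hf : LatticeConvex f c) (hP : Preprocessed f P)
    {V : Matrix (Fin 2) (Fin 2) ℤ} (hV : FlipTo f P V) (hc : Q.carrier = latticeCell P.z V)
    (hQ : Preprocessed f Q) (hin : InIntr f P p q) (hpt : Q.pt p' q' = P.pt p q)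
    (hinQ : ∀ v ∈ Q.carrier, cutVal f v (P.pt p q) < 0) : StepBound f P Q p q p' q' := by
  cases hV with
  | case1 h =>
    rw [← P.pt_zero] at h
    rw [latticeCell_eq_sub P _ 0 0 _ (det_signs (P.gA f 0 0) (P.gB f 0 0))
      (by rw [flipSign_eq_gA]; module) (by rw [flipSign_eq_gB]; module)] at hc
    exact step_single hf h rfl rfl _ hc hpt
  | case2a h hA =>
    rw [← P.pt_one_one, ← P.pt_zero] at h
    unfold CondA at hA
    rw [latticeCell_eq_sub P 1 0 1 1 (by norm_num) (by module) (by module)] at hc hA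
    rw [← P.pt_two_one, ← P.pt_one_one, ← P.pt_neg_one_zero, ← P.pt_zero, strictlyCuts_iff,
      strictlyCuts_iff] at hA
    have hcuts := diag_cuts hP h
    exact step_diag_first hf h hcuts.1 hcuts.2 hin _ hA hc hpt hQ hinQ
  | case2b h hA hB =>
    rw [← P.pt_one_one, ← P.pt_zero] at h
    unfold CondB at hB
    rw [latticeCell_eq_sub P (-1) 0 1 1 (by norm_num) (by module) (by module)] at hc hB
    rw [← P.pt_two_one, ← P.pt_one_one, ← P.pt_neg_one_zero, ← P.pt_zero, strictlyCuts_iff,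
      strictlyCuts_iff] at hB
    have hcuts := diag_cuts hP h
    exact step_diag_second hf h hcuts.1 hcuts.2 hin _ hB hc hpt hQ hinQ
  | case2c h hA hB =>
    rw [← P.pt_one_one, ← P.pt_zero] at h
    rw [latticeCell_eq_sub P (-1) 0 2 1 (by norm_num) (by module) (by module)] at hc
    have hcuts := diag_cuts hP h
    exact step_diag_third hf h hcuts.1 hcuts.2 hin _ hc hpt hQ hinQ
  | case3 i k hi h hH hk =>
    rw [← P.pt_one_zero, ← P.pt_zero] at h
    rw [pt_mem_latticeH] at hk
    have huniq := unique_of_encard hH hk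
    rw [latticeCell_eq_sub P k i (1 - k) (-i) (det_pair k hi) rfl (by module)] at hc
    have hz : P.pt 0 0 ∈ activeSet f P.carrier := by rw [h]; simp
    have hb : P.pt 1 0 ∈ activeSet f P.carrier := by rw [h]; simp
    have hq0 := row_ne_zero hz hb hin
    have hii : i * i = 1 := by rcases hi with rfl | rfl <;> norm_num
    rcases lt_or_ge (q * i) 1 with hlt | hge
    -- The optimum is on the side opposite to `i`. By `opposite_rows` that side has the single point
    -- `l = 1 - k`, and the flip defined from `l` spans the same cell.
    · have hne : q * i ≠ 0 := mul_ne_zero hq0 (by rintro rfl; omega)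
      have hqe : q = -(q * i) * -i := by linear_combination (-q) * hii
      obtain ⟨l, hl⟩ := exists_row_point (s := -i) (n := -(q * i)) (p := p) hz hb (by omega)
        (by rwa [← hqe])
      have hkl := opposite_rows hz hb hk hl
      obtain rfl : k = 1 - l := by omega
      refine step_unique_row (s := -i) (k := l) (n := -(q * i)) hf h (by omega) (by omega)
        hqe hin hl ?_ (det_pair l (by omega)) (hc.trans ?_) hpt hQ hinQ
      · intro m hm
        have := opposite_rows hz hb hk hm
        omega
      · ext w
        rw [P.carrier_sub, P.carrier_sub]
        norm_num
        tauto
    · exact step_unique_row hf h hi.symm hge (by linear_combination (-q) * hii) hin hk huniq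
        (det_pair k hi) hc hpt hQ hinQ
  | case4pos i k hi h hH hk hmin hs =>
    rw [← P.pt_one_zero, ← P.pt_zero] at h
    rw [pt_mem_latticeH] at hk
    obtain ⟨l, hl, hlk⟩ := exists_ne_of_encard k hH
    rw [latticeCell_eq_sub P 1 0 k i (det_row k hi) (by module) rfl] at hc
    exact step_row hf h hi hin hk hl hlk (fun l hl => hmin l (pt_mem_latticeH.mpr hl))
      (Or.inl ⟨hs, rfl⟩) _ hc hpt hQ hinQ
  | case4neg i k hi h hH hk hmin hs =>
    rw [← P.pt_one_zero, ← P.pt_zero] at h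
    rw [pt_mem_latticeH] at hk
    obtain ⟨l, hl, hlk⟩ := exists_ne_of_encard k hH
    rw [latticeCell_eq_sub P 1 0 (k - 1) i (det_row (k - 1) hi) (by module) rfl] at hc
    exact step_row hf h hi hin hk hl hlk (fun l hl => hmin l (pt_mem_latticeH.mpr hl))
      (Or.inr ⟨hs, rfl⟩) _ hc hpt hQ hinQ
  | case5pos h hH =>
    rw [← P.pt_one_zero, ← P.pt_zero_one, ← P.pt_zero] at h
    obtain ⟨k, hk⟩ := exists_of_encard hH
    rw [latticeCell_eq_sub P 1 0 (-1) 1 (by norm_num) (by module) (by module)] at hc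
    exact step_corner_pos h hin hk _ hc hpt
  | case5neg h hH =>
    rw [← P.pt_one_zero, ← P.pt_zero_one, ← P.pt_zero] at h
    obtain ⟨k, hk⟩ := exists_of_encard hH
    rw [latticeCell_eq_sub P 1 (-1) 0 1 (by norm_num) (by module) (by module)] at hc
    exact step_corner_neg h hin hk _ hc hpt

/-! ### Existence of preprocessed labellings and of updates -/

lemma exists_preprocessed_of_anchor (P : UniSet)
    (hz : P.pt 0 0 ∈ activeSet f P.carrier) :
    ∃ Q : UniSet, Q.carrier = P.carrier ∧ Preprocessed f Q := by
  have mk : ∀ M : UniSet, M.carrier = P.carrier → M.pt 0 0 ∈ activeSet f P.carrier →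
      ((activeSet f P.carrier).ncard = 2 → activeSet f P.carrier = {M.pt 0 0, M.pt 1 0} ∨
        (activeSet f P.carrier = {M.pt 0 0, M.pt 1 1} ∧ 0 < cutVal f (M.pt 0 0) (M.pt 1 0) ∧
          0 < cutVal f (M.pt 1 1) (M.pt 0 1))) →
      ((activeSet f P.carrier).ncard = 3 →
        activeSet f P.carrier = {M.pt 0 0, M.pt 1 0, M.pt 0 1}) →
      ∃ Q : UniSet, Q.carrier = P.carrier ∧ Preprocessed f Q := by
    intro M hM h0 h2 h3
    refine ⟨M, hM, ?_⟩
    unfold Preprocessed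
    rw [hM, ← M.pt_one_one, ← M.pt_one_zero, ← M.pt_zero_one, ← M.pt_zero]
    exact ⟨h0.2, h2, h3⟩
  have hA := activeSet_eq_of hz
  have two : ∀ {a b : Lattice2}, a ≠ b → ({a, b} : Set Lattice2).ncard = 2 :=
    fun hab => Set.ncard_pair hab
  have three : ∀ {a b d : Lattice2}, a ≠ b → a ≠ d → b ≠ d →
      ({a, b, d} : Set Lattice2).ncard = 3 := by
    intro a b d h1 h2 h3
    exact Set.ncard_eq_three.mpr ⟨a, b, d, h1, h2, h3, rfl⟩
  by_cases hb : P.pt 1 0 ∈ activeSet f P.carrier <;>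
  by_cases hd : P.pt 0 1 ∈ activeSet f P.carrier <;>
  by_cases he : P.pt 1 1 ∈ activeSet f P.carrier <;>
  simp only [hb, hd, he, and_true, and_false, or_false, false_or] at hA
  · have e : activeSet f P.carrier = {P.pt 0 0, P.pt 1 0, P.pt 0 1, P.pt 1 1} := by
      ext w; rw [hA]; simp
    have h4 : (activeSet f P.carrier).ncard = 4 := by
      rw [e, Set.ncard_insert_of_notMem (by simp [P.pt_inj]) (Set.toFinite _),
        three (by simp [P.pt_inj]) (by simp [P.pt_inj]) (by simp [P.pt_inj])]
    exact mk P rfl hz (by omega) (by omega)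
  · have e : activeSet f P.carrier = {P.pt 0 0, P.pt 1 0, P.pt 0 1} := by ext w; rw [hA]; simp
    have h3 : (activeSet f P.carrier).ncard = 3 := by
      rw [e]; apply three <;> simp [P.pt_inj]
    exact mk P rfl hz (by omega) (fun _ => e)
  · have e : activeSet f P.carrier = {P.pt 0 0, P.pt 1 0, P.pt 1 1} := by ext w; rw [hA]; simp
    have h3 : (activeSet f P.carrier).ncard = 3 := by
      rw [e]; apply three <;> simp [P.pt_inj]
    refine mk (P.sub 1 0 (-1) 0 0 1 (by norm_num)) ?_ ?_ (by omega) (fun _ => ?_)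
    · ext w; rw [P.carrier_sub, P.mem_carrier]; norm_num; tauto
    · rw [P.sub_pt]; simpa using hb
    · rw [e]; simp only [P.sub_pt]; ext w
      simp only [Set.mem_insert_iff, Set.mem_singleton_iff]; norm_num; tauto
  · have e : activeSet f P.carrier = {P.pt 0 0, P.pt 1 0} := by ext w; rw [hA]; simp
    have h2 : (activeSet f P.carrier).ncard = 2 := by
      rw [e]; apply two; simp [P.pt_inj]
    exact mk P rfl hz (fun _ => Or.inl e) (by omega)
  · have e : activeSet f P.carrier = {P.pt 0 0, P.pt 0 1, P.pt 1 1} := by ext w; rw [hA]; simp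
    have h3 : (activeSet f P.carrier).ncard = 3 := by
      rw [e]; apply three <;> simp [P.pt_inj]
    refine mk (P.sub 0 1 1 0 0 (-1) (by norm_num)) ?_ ?_ (by omega) (fun _ => ?_)
    · ext w; rw [P.carrier_sub, P.mem_carrier]; norm_num; tauto
    · rw [P.sub_pt]; simpa using hd
    · rw [e]; simp only [P.sub_pt]; ext w
      simp only [Set.mem_insert_iff, Set.mem_singleton_iff]; norm_num; tauto
  · have e : activeSet f P.carrier = {P.pt 0 0, P.pt 0 1} := by ext w; rw [hA]; simp
    have h2 : (activeSet f P.carrier).ncard = 2 := by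
      rw [e]; apply two; simp [P.pt_inj]
    refine mk (P.sub 0 0 0 1 1 0 (by norm_num)) ?_ ?_ (fun _ => Or.inl ?_) (by omega)
    · ext w; rw [P.carrier_sub, P.mem_carrier]; norm_num; tauto
    · rw [P.sub_pt]; simpa using hz
    · rw [e]; simp only [P.sub_pt]; norm_num
  · have e : activeSet f P.carrier = {P.pt 0 0, P.pt 1 1} := by ext w; rw [hA]; simp
    have h2 : (activeSet f P.carrier).ncard = 2 := by
      rw [e]; apply two; simp [P.pt_inj]
    have cb := exists_cut (by simp [P.pt_mem_carrier]) hb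
    have cd := exists_cut (by simp [P.pt_mem_carrier]) hd
    rw [active00] at hz
    rw [active11] at he
    rw [exists_carrier] at cb cd
    have hz' := active00.mpr hz
    obtain ⟨z1, z2, z3⟩ := hz
    obtain ⟨e1, e2, e3⟩ := he
    simp only [P.cutVal_pt] at cb cd
    norm_num at cb cd
    -- Each inactive vertex is cut by an active one, and neither active vertex cuts both neighbours,
    -- since it does not cut the opposite vertex. The required cuts thus hold in one of the two
    -- orders of the columns.
    by_cases hg : 0 < P.gA f 0 0
    · have hg2 : P.gA f 1 1 < 0 := by
        rcases cd with h | h | h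
        · linarith
        · linarith
        · exact h
      refine mk P rfl hz' (fun _ => Or.inr ⟨e, ?_, ?_⟩) (by omega)
      · rw [P.cutVal_pt]; norm_num; exact hg
      · rw [P.cutVal_pt]; norm_num; exact hg2
    · have hg2 : P.gB f 1 1 < 0 := by
        rcases cb with h | h | h
        · exact absurd h hg
        · linarith
        · exact h
      have hg3 : 0 < P.gB f 0 0 := by
        rcases cd with h | h | h
        · exact h
        · linarith
        · linarith
      refine mk (P.sub 0 0 0 1 1 0 (by norm_num)) ?_ ?_ (fun _ => Or.inr ⟨?_, ?_, ?_⟩) (by omega)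
      · ext w; rw [P.carrier_sub, P.mem_carrier]; norm_num; tauto
      · rw [P.sub_pt]; simpa using hz'
      · rw [e]; simp only [P.sub_pt]; norm_num
      · rw [P.sub_pt, P.sub_pt, P.cutVal_pt]; norm_num; exact hg3
      · rw [P.sub_pt, P.sub_pt, P.cutVal_pt]; norm_num; exact hg2
  · have e : activeSet f P.carrier = {P.pt 0 0} := by ext w; rw [hA]; simp
    have h1 : (activeSet f P.carrier).ncard = 1 := by rw [e]; exact Set.ncard_singleton _
    exact mk P rfl hz (by omega) (by omega)

/-- A minimiser of `f` on the cell is active and can serve as the anchor. -/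
lemma exists_preprocessed (hf : LatticeConvex f c) (P : UniSet) :
    ∃ Q : UniSet, Q.carrier = P.carrier ∧ Preprocessed f Q := by
  obtain ⟨w, hw⟩ := exists_isMinOf f P
  have hwA := hw.mem_activeSet hf
  obtain ⟨i, j, rfl⟩ := P.exists_pt w
  have hij := P.pt_mem_carrier.mp hw.1
  have hdet : |(1 - 2 * i) * (1 - 2 * j) - 0 * 0| = 1 := by
    rcases hij with ⟨rfl | rfl, rfl | rfl⟩ <;> norm_num
  have hM : (P.sub i j (1 - 2 * i) 0 0 (1 - 2 * j) hdet).carrier = P.carrier := by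
    apply sub_carrier_of_coords P _ i j hij.1 hij.2
    left
    intro x y
    rw [P.sub_pt]
    congr 1 <;> ring
  obtain ⟨Q, hQ, hQ'⟩ := exists_preprocessed_of_anchor _
    (by rw [hM, P.sub_pt]; simpa using hwA :
      (P.sub i j (1 - 2 * i) 0 0 (1 - 2 * j) hdet).pt 0 0 ∈
        activeSet f (P.sub i j (1 - 2 * i) 0 0 (1 - 2 * j) hdet).carrier)
  exact ⟨Q, hQ.trans hM, hQ'⟩

lemma exists_update (hf : LatticeConvex f c) (h : CanUpdate f P) : ∃ Q, Update f P Q := by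
  obtain ⟨V, hV⟩ := h.2
  obtain ⟨N, hN⟩ := hV.spec.1
  obtain ⟨Q, hQ, hQ'⟩ := exists_preprocessed hf N
  exact ⟨Q, h, V, hV, hQ.trans hN, hQ'⟩

lemma exists_isRun (hf : LatticeConvex f c) (P : UniSet) : ∃ s, IsRun f P s := by
  classical
  have : ∀ P : UniSet, ∃ Q, Update f P Q ∨ (¬ CanUpdate f P ∧ Q = P) := by
    intro P
    by_cases h : CanUpdate f P
    · obtain ⟨Q, hQ⟩ := exists_update hf h
      exact ⟨Q, Or.inl hQ⟩
    · exact ⟨P, Or.inr ⟨h, rfl⟩⟩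
  choose g hg using this
  refine ⟨fun n => g^[n] P, rfl, fun i => ?_⟩
  have := hg (g^[i] P)
  rwa [← Function.iterate_succ_apply' g i P] at this

end Updates

/-! ### The bound on the number of updates -/

section Bound

variable {f : Plane → ℝ} {c : ℝ} {P Q : UniSet} {p q p' q' : ℤ}

lemma exists_flipTo_edge (hA : activeSet f P.carrier = {P.pt 0 0, P.pt 1 0}) {i k : ℤ}
    (hi : i = -1 ∨ i = 1) (hk : InIntr f P k i) : ∃ V, FlipTo f P V := by
  have hA' : activeSet f P.carrier = {P.z, P.z + P.u1} := by rw [hA, P.pt_one_zero, P.pt_zero]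
  by_cases huniq : ∀ l, InIntr f P l i → l = k
  · have : latticeH f P i = {P.pt k i} := by
      ext w
      rw [mem_latticeH, Set.mem_singleton_iff]
      constructor
      · rintro ⟨l, rfl, hl⟩
        rw [huniq l hl]
      · rintro rfl
        exact ⟨k, rfl, hk⟩
    exact ⟨_, FlipTo.case3 i k hi hA' (by rw [this]; exact Set.encard_singleton _)
      (pt_mem_latticeH.mpr hk)⟩
  · push Not at huniq
    obtain ⟨l, hl, hlk⟩ := huniq
    have h1 : 1 < (latticeH f P i).encard := by
      rw [Set.one_lt_encard_iff]
      exact ⟨P.pt k i, P.pt l i, mem_latticeH.mpr ⟨k, rfl, hk⟩, mem_latticeH.mpr ⟨l, rfl, hl⟩,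
        fun h => hlk (P.pt_inj.mp h).1.symm⟩
    have h2 : 2 ≤ (latticeH f P i).encard := by
      rw [← one_add_one_eq_two]
      exact Order.add_one_le_of_lt h1
    set S : Set ℤ := {l | InIntr f P l i} with hS
    have hne : S.Nonempty := ⟨k, hk⟩
    have hm := Function.argminOn_mem (fun l : ℤ => l.natAbs) S hne
    have hmin := fun l hl => Function.argminOn_le (fun l : ℤ => l.natAbs) S (a := l) hl
    set m := Function.argminOn (fun l : ℤ => l.natAbs) S hne
    have hmin' : ∀ l : ℤ, P.z + l • P.u1 + i • P.u2 ∈ latticeH f P i → |m| ≤ |l| := by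
      intro l hl
      have : m.natAbs ≤ l.natAbs := hmin l (pt_mem_latticeH.mp hl)
      rw [Int.abs_eq_natAbs, Int.abs_eq_natAbs]
      exact_mod_cast this
    rcases lt_or_ge m 0 with h | h
    · exact ⟨_, FlipTo.case4neg i m hi hA' h2 (pt_mem_latticeH.mpr hm) hmin' (by omega)⟩
    · exact ⟨_, FlipTo.case4pos i m hi hA' h2 (pt_mem_latticeH.mpr hm) hmin' h⟩

lemma exists_side_point (hz : P.pt 0 0 ∈ activeSet f P.carrier)
    (hb : P.pt 1 0 ∈ activeSet f P.carrier) (hin : InIntr f P p q) :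
    (∃ k, InIntr f P k 1) ∨ ∃ k, InIntr f P k (-1) := by
  have hq := row_ne_zero hz hb hin
  rcases lt_or_gt_of_ne hq with h | h
  · right
    exact exists_row_point (n := -q) hz hb (by omega) (by simpa using hin)
  · left
    exact exists_row_point (n := q) hz hb (by omega) (by simpa using hin)

/-- An interior lattice point excludes four active vertices. For an active edge or corner,
`exists_side_point` moves it into a row next to the edge, where the table looks. -/
lemma exists_flipTo (hP : Preprocessed f P) (hin : InIntr f P p q) : ∃ V, FlipTo f P V := by
  rcases hP.shape with h | h | ⟨h, -⟩ | h | ⟨h1, h2, h3, h4⟩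
  · rw [P.pt_zero] at h
    exact ⟨_, FlipTo.case1 h⟩
  · rcases exists_side_point (by rw [h]; simp) (by rw [h]; simp) hin with ⟨k, hk⟩ | ⟨k, hk⟩
    · exact exists_flipTo_edge h (Or.inr rfl) hk
    · exact exists_flipTo_edge h (Or.inl rfl) hk
  · rw [P.pt_one_one, P.pt_zero] at h
    by_cases hA : CondA f P
    · exact ⟨_, FlipTo.case2a h hA⟩
    · by_cases hB : CondB f P
      · exact ⟨_, FlipTo.case2b h hA hB⟩
      · exact ⟨_, FlipTo.case2c h hA hB⟩
  · have hside := exists_side_point (by rw [h]; simp) (by rw [h]; simp) hin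
    rw [P.pt_one_zero, P.pt_zero_one, P.pt_zero] at h
    rcases hside with ⟨k, hk⟩ | ⟨k, hk⟩
    · exact ⟨_, FlipTo.case5pos h
        (Set.one_le_encard_iff_nonempty.mpr ⟨_, mem_latticeH.mpr ⟨k, rfl, hk⟩⟩)⟩
    · exact ⟨_, FlipTo.case5neg h
        (Set.one_le_encard_iff_nonempty.mpr ⟨_, mem_latticeH.mpr ⟨k, rfl, hk⟩⟩)⟩
  · exact absurd hin (not_all_active h1 h2 h3 h4)

lemma isOptimal_of_gradient_eq_zero (hf : LatticeConvex f c) {w : Lattice2}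
    (h : gradient f (emb w) = 0) : IsOptimal f w := by
  intro x
  by_cases hx : w = x
  · rw [hx]
  · have := hf.2 w x hx
    have h0 : cutVal f w x = 0 := by simp [cutVal, h]
    have := hf.1
    show latVal f w ≤ latVal f x
    linarith

lemma canUpdate_of_not_containsOptimal (hf : LatticeConvex f c) (hP : Preprocessed f P)
    {zs : Lattice2} (hzs : IsOptimal f zs) (h : ¬ ContainsOptimal f P) : CanUpdate f P := by
  obtain ⟨p, q, rfl⟩ := P.exists_pt zs
  exact ⟨fun w hw hg => h ⟨w, hw, isOptimal_of_gradient_eq_zero hf hg⟩,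
    exists_flipTo hP (hzs.inIntr hf fun hmem => h ⟨_, hmem, hzs⟩)⟩

/-- One update decreases the potential by one, or it decreases the minimum of `f` by `c` and
increases the potential by at most five. -/
lemma update_decrease (hf : LatticeConvex f c) (hP : Preprocessed f P) (hup : Update f P Q)
    (hin : InIntr f P p q) (hpt : Q.pt p' q' = P.pt p q)
    (hinQ : ∀ v ∈ Q.carrier, cutVal f v (P.pt p q) < 0) {w : Lattice2}
    (hw : IsMinOf f P.carrier w) {w' : Lattice2} (hw' : IsMinOf f Q.carrier w') :
    (pot f Q p' q' + 1 ≤ pot f P p q ∧ latVal f w' ≤ latVal f w) ∨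
      (pot f Q p' q' ≤ pot f P p q + 5 ∧ latVal f w' + c ≤ latVal f w) := by
  obtain ⟨-, V, hV, hc, hQ⟩ := hup
  obtain ⟨h1, h2⟩ := hV.stepBound hf hP hc hQ hin hpt hinQ
  have hwQ : w ∈ Q.carrier := by
    rw [hc]
    exact hV.spec.2 (hw.mem_activeSet hf)
  by_cases hwA : w ∈ activeSet f Q.carrier
  · exact Or.inl ⟨h2 w hw hwA, hw'.2 w hwQ⟩
  · right
    obtain ⟨v, hv, hcut⟩ := exists_cut hwQ hwA
    have := hf.drop hcut
    have := hw'.2 v hv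
    exact ⟨h1, by linarith⟩

/-- Outside the cell `rad ≥ 1`, and the largest correction is `-4`. -/
lemma neg_one_le_pot (h : P.pt p q ∉ P.carrier) : -1 ≤ pot f P p q := by
  have h1 : 1 ≤ rad p q := by
    rw [P.pt_mem_carrier] at h
    unfold rad dist01
    omega
  have h2 : ∀ a b, 0 ≤ rad a b := by
    intro a b
    unfold rad dist01
    omega
  unfold pot
  have := h2 (descentSign (P.gA f 0 0) * p) (descentSign (P.gB f 0 0) * q)
  split_ifs <;> omega

lemma IsRun.preprocessed {P₀ : UniSet} {s : ℕ → UniSet} (hs : IsRun f P₀ s)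
    (hP : Preprocessed f P₀) (i : ℕ) : Preprocessed f (s i) := by
  induction i with
  | zero => rw [hs.1]; exact hP
  | succ i ih =>
    rcases hs.2 i with ⟨-, V, -, -, h⟩ | ⟨-, h⟩
    · exact h
    · rw [h]; exact ih

lemma IsRun.update_of_not_containsOptimal (hf : LatticeConvex f c) {P₀ : UniSet}
    {s : ℕ → UniSet} (hs : IsRun f P₀ s) (hP : Preprocessed f P₀) {zs : Lattice2}
    (hzs : IsOptimal f zs) {i : ℕ} (h : ¬ ContainsOptimal f (s i)) :
    Update f (s i) (s (i + 1)) :=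
  (hs.2 i).resolve_right fun h' =>
    h'.1 (canUpdate_of_not_containsOptimal hf (hs.preprocessed hP i) hzs h)

/-- The weight `6` turns a drop of `c` in the minimum into a gain of six, which covers a rise of
five in the potential and leaves one. -/
lemma IsRun.potential_bound (hf : LatticeConvex f c) {P₀ : UniSet} {s : ℕ → UniSet}
    (hs : IsRun f P₀ s) (hP : Preprocessed f P₀) (hzs : IsOptimal f (P₀.pt p q))
    {w₀ : Lattice2} (hw₀ : IsMinOf f P₀.carrier w₀) (n : ℕ)
    (hn : ∀ i ≤ n, ¬ ContainsOptimal f (s i)) :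
    ∃ w p' q', IsMinOf f (s n).carrier w ∧ (s n).pt p' q' = P₀.pt p q ∧
      (pot f (s n) p' q' : ℝ) + 6 * (latVal f w / c) + n ≤
        (pot f P₀ p q : ℝ) + 6 * (latVal f w₀ / c) := by
  induction n with
  | zero => exact ⟨w₀, p, q, by rw [hs.1]; exact hw₀, by rw [hs.1], by rw [hs.1]; simp⟩
  | succ n ih =>
    obtain ⟨w, p', q', hw, hpt, hle⟩ := ih fun i hi => hn i (by omega)
    obtain ⟨w', hw'⟩ := exists_isMinOf f (s (n + 1))
    obtain ⟨a, b, hab⟩ := (s (n + 1)).exists_pt (P₀.pt p q)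
    refine ⟨w', a, b, hw', hab, ?_⟩
    have hno : ∀ i ≤ n + 1, P₀.pt p q ∉ (s i).carrier := fun i hi hmem => hn i hi ⟨_, hmem, hzs⟩
    have hin : InIntr f (s n) p' q' := by
      apply IsOptimal.inIntr hf
      · rw [hpt]; exact hzs
      · rw [hpt]; exact hno n (by omega)
    have hin' : InIntr f (s (n + 1)) a b := by
      apply IsOptimal.inIntr hf
      · rw [hab]; exact hzs
      · rw [hab]; exact hno (n + 1) le_rfl
    have hup := hs.update_of_not_containsOptimal hf hP hzs (hn n (by omega))
    have hc := hf.1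
    rcases update_decrease hf (hs.preprocessed hP n) hup hin (hab.trans hpt.symm)
      (fun v hv => by rw [hpt, ← hab]; exact hin' v hv) hw hw' with ⟨h1, h2⟩ | ⟨h1, h2⟩
    · have h1' : (pot f (s (n + 1)) a b : ℝ) + 1 ≤ pot f (s n) p' q' := by exact_mod_cast h1
      have h3 : latVal f w' / c ≤ latVal f w / c := by gcongr
      push_cast
      linarith
    · have h1' : (pot f (s (n + 1)) a b : ℝ) ≤ pot f (s n) p' q' + 5 := by exact_mod_cast h1
      have h3 : latVal f w' / c + 1 ≤ latVal f w / c := by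
        rw [← div_self hc.ne', ← add_div]
        gcongr
      push_cast
      linarith

/-! ### The initial potential -/

lemma exists_rDist_eq (P : UniSet) (x : Lattice2) :
    ∃ i j p q : ℤ, P.pt i j ∈ P.carrier ∧ P.pt p q = x ∧
      (rDist P x : ℤ) = |p - i| + |q - j| := by
  have hne : {n : ℕ | ∃ w ∈ P.carrier, n = ∑ i, ((P.U⁻¹).mulVec (x - w) i).natAbs}.Nonempty :=
    ⟨_, P.pt 0 0, by simp [P.pt_mem_carrier], rfl⟩
  obtain ⟨w, hw, hr⟩ := Nat.sInf_mem hne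
  obtain ⟨i, j, rfl⟩ := P.exists_pt w
  obtain ⟨p, q, rfl⟩ := P.exists_pt x
  refine ⟨i, j, p, q, hw, rfl, ?_⟩
  have hdet : IsUnit P.U.det := by
    rw [Int.isUnit_iff]
    exact eq_or_eq_neg_of_abs_eq P.abs_det
  have hdiff : P.pt p q - P.pt i j = P.U.mulVec ![p - i, q - j] := by
    rw [P.mulVec_eq]
    simp only [UniSet.pt, Matrix.cons_val_zero, Matrix.cons_val_one]
    module
  rw [hdiff, Matrix.mulVec_mulVec, Matrix.nonsing_inv_mul _ hdet, Matrix.one_mulVec] at hr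
  unfold rDist
  rw [hr]
  simp [Fin.sum_univ_two]

/-- Labellings of the unit square differ by reflections and an exchange of axes, so its coordinates
are Euclidean. -/
lemma norm_sub_sq_of_unit_cell {z₀ : Lattice2} (hc : P.carrier = latticeCell z₀ 1)
    (i j p q : ℤ) :
    ‖emb (P.pt p q) - emb (P.pt i j)‖ ^ 2 = ((p - i : ℤ) : ℝ) ^ 2 + ((q - j : ℤ) : ℝ) ^ 2 := by
  set N : UniSet := ⟨z₀, 1, by simp⟩ with hN
  have hNpt : ∀ x y, N.pt x y = z₀ + ![x, y] := by
    intro x y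
    funext t
    rw [N.pt_apply]
    fin_cases t <;> simp [hN, UniSet.u1, UniSet.u2]
  rw [← emb_sub, norm_emb_sq]
  obtain ⟨a, b, ha, hb, h | h⟩ := N.relabel P hc
  · rw [h, h, hNpt, hNpt]
    simp only [Pi.add_apply, Pi.sub_apply, Matrix.cons_val_zero, Matrix.cons_val_one]
    rcases ha with rfl | rfl <;> rcases hb with rfl | rfl <;> push_cast <;> ring
  · rw [h, h, hNpt, hNpt]
    simp only [Pi.add_apply, Pi.sub_apply, Matrix.cons_val_zero, Matrix.cons_val_one]
    rcases ha with rfl | rfl <;> rcases hb with rfl | rfl <;> push_cast <;> ring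

/-- `K` may have empty interior, so the gradient itself need not be bounded by `L`; only one-sided
difference quotients along the segment from `x` to `y` are controlled. -/
lemma neg_mul_le_inner_gradient {L : NNReal} {K : Set Plane} (hd : Differentiable ℝ f)
    (hK : Convex ℝ K) (hL : LipschitzOnWith L f K) {x y : Plane} (hx : x ∈ K) (hy : y ∈ K) :
    -(L * ‖y - x‖) ≤ inner ℝ (gradient f x) (y - x) := by
  have h1 : HasDerivAt (fun t : ℝ => f (x + t • (y - x))) (inner ℝ (gradient f x) (y - x)) 0 :=
    (hd x).hasGradientAt.hasFDerivAt.hasLineDerivAt (y - x)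
  refine ge_of_tendsto h1.tendsto_slope_zero_right ?_
  have : Set.Ioc (0 : ℝ) 1 ∈ nhdsWithin 0 (Set.Ioi 0) :=
    Ioc_mem_nhdsGT (by norm_num)
  filter_upwards [this] with t ht
  have hmem : x + t • (y - x) ∈ K := hK.add_smul_sub_mem hx hy ⟨ht.1.le, ht.2⟩
  have h2 := hL.dist_le_mul _ hmem _ hx
  rw [Real.dist_eq, dist_eq_norm, add_sub_cancel_left, norm_smul, Real.norm_of_nonneg ht.1.le]
    at h2
  have h3 := (abs_le.mp h2).1
  simp only [zero_add, zero_smul, add_zero, smul_eq_mul]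
  rw [← sub_nonneg]
  have h4 : t⁻¹ * (f (x + t • (y - x)) - f x) - -(L * ‖y - x‖) =
      t⁻¹ * (f (x + t • (y - x)) - f x + L * (t * ‖y - x‖)) := by
    field_simp [ht.1.ne']
    ring
  rw [h4]
  exact mul_nonneg (inv_nonneg.mpr ht.1.le) (by linarith)

lemma Setting.bound {L : NNReal} {K : Set Plane} {z₀ : Lattice2} {P₀ : UniSet} {zs : Lattice2}
    (S : Setting f L c K z₀ P₀ zs) {s : ℕ → UniSet} (hs : IsRun f P₀ s) (n : ℕ)
    (hn : ∀ i ≤ n, ¬ ContainsOptimal f (s i)) :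
    (n : ℝ) + 1 ≤ (6 * (L : ℝ) / c + 2) * (rDist P₀ zs : ℝ) := by
  have hf := S.stronglyConvex.latticeConvex S.c_pos
  obtain ⟨i, j, p, q, hmem, rfl, hr⟩ := exists_rDist_eq P₀ zs
  obtain ⟨w₀, hw₀⟩ := exists_isMinOf f P₀
  obtain ⟨w, p', q', hw, hpt, hle⟩ := hs.potential_bound hf S.preprocessed S.optimal hw₀ n hn
  have hno : ∀ i ≤ n, P₀.pt p q ∉ (s i).carrier := fun i hi h => hn i hi ⟨_, h, S.optimal⟩
  have hlow : (-1 : ℝ) ≤ pot f (s n) p' q' := by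
    have := neg_one_le_pot (f := f) (P := s n) (p := p') (q := q')
      (by rw [hpt]; exact hno n le_rfl)
    exact_mod_cast this
  set a := p - i with ha
  set b := q - j with hb
  set r := rDist P₀ (P₀.pt p q) with hrdef
  have hij := P₀.pt_mem_carrier.mp hmem
  have hpot : (pot f P₀ p q : ℝ) ≤ 3 * r + 3 := by
    have h1 := pot_le (f := f) (Q := P₀) (N := P₀) (p := p) (q := q) rfl rfl
    have h2 : rad p q ≤ r := by
      rw [hr]
      have a1 := le_abs_self a
      have a2 := neg_le_abs a
      have b1 := le_abs_self b
      have b2 := neg_le_abs b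
      unfold rad dist01
      omega
    have : pot f P₀ p q ≤ 3 * r + 3 := by omega
    exact_mod_cast this
  have hab : 1 ≤ a ^ 2 + b ^ 2 ∧ |a| + |b| ≤ a ^ 2 + b ^ 2 := by
    have h0 : a ≠ 0 ∨ b ≠ 0 := by
      by_contra hcon
      push Not at hcon
      have h1 : p = i := by omega
      have h2 : q = j := by omega
      apply hno 0 (by omega)
      rw [hs.1, h1, h2]
      exact hmem
    have ha2 : |a| ≤ a ^ 2 := by
      rw [← sq_abs]
      nlinarith [abs_nonneg a, Int.le_self_sq |a|]
    have hb2 : |b| ≤ b ^ 2 := by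
      rw [← sq_abs]
      nlinarith [abs_nonneg b, Int.le_self_sq |b|]
    refine ⟨?_, by linarith⟩
    rcases h0 with h0 | h0
    · have := abs_pos.mpr h0
      nlinarith [sq_nonneg b]
    · have := abs_pos.mpr h0
      nlinarith [sq_nonneg a]
  set x := emb (P₀.pt i j) with hx
  set y := emb (P₀.pt p q) with hy
  have hd2 : ‖y - x‖ ^ 2 = (a : ℝ) ^ 2 + (b : ℝ) ^ 2 := norm_sub_sq_of_unit_cell S.carrier_eq i j p q
  have hrR : (r : ℝ) = |(a : ℝ)| + |(b : ℝ)| := by exact_mod_cast hr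
  have hd : ‖y - x‖ ≤ r := by
    refine le_of_sq_le_sq ?_ (by positivity)
    rw [hd2, hrR]
    nlinarith [abs_nonneg (a : ℝ), abs_nonneg (b : ℝ), sq_abs (a : ℝ), sq_abs (b : ℝ)]
  have hgap : latVal f w₀ ≤ latVal f (P₀.pt p q) + (L * r - c * ((a : ℝ) ^ 2 + (b : ℝ) ^ 2)) := by
    have h1 := S.stronglyConvex x y
    have h2 := neg_mul_le_inner_gradient S.differentiable S.convex S.lipschitz
      (S.carrier_mem _ hmem) S.optimal_mem
    have h3 := hw₀.2 _ hmem
    have h4 : (L : ℝ) * ‖y - x‖ ≤ L * r := mul_le_mul_of_nonneg_left hd L.2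
    rw [hd2] at h1
    unfold latVal at *
    linarith
  have hopt : latVal f (P₀.pt p q) ≤ latVal f w := S.optimal w
  have hc := S.c_pos
  have hdiv : latVal f w₀ / c - latVal f w / c ≤ L * r / c - ((a : ℝ) ^ 2 + (b : ℝ) ^ 2) := by
    rw [← sub_div, ← sub_nonneg]
    have : L * r / c - ((a : ℝ) ^ 2 + (b : ℝ) ^ 2) - (latVal f w₀ - latVal f w) / c =
        (L * r - c * ((a : ℝ) ^ 2 + (b : ℝ) ^ 2) - (latVal f w₀ - latVal f w)) / c := by
      field_simp
    rw [this]
    exact div_nonneg (by linarith) hc.le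
  have hab1 : (1 : ℝ) ≤ (a : ℝ) ^ 2 + (b : ℝ) ^ 2 := by exact_mod_cast hab.1
  have hab2 : (r : ℝ) ≤ (a : ℝ) ^ 2 + (b : ℝ) ^ 2 := by
    rw [hrR]
    exact_mod_cast hab.2
  have hexp : (6 * (L : ℝ) / c + 2) * r = 6 * (L * r / c) + 2 * r := by ring
  rw [hexp]
  -- With `D = a ^ 2 + b ^ 2` the estimates give `n ≤ 3 * r + 4 + 6 * (L * r / c) - 6 * D`. Using `D
  -- ≥ r` once and `D ≥ 1` five times yields the claim, including the extra one.
  linarith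

end Bound

/-! ### An example whose final gradient polyhedron is not lattice-free -/

namespace NonLatticeFree

/-- The continuous minimiser of the example. -/
noncomputable def centre : Plane := !₂[-7 / 5, -1 / 10]

/-- The squared distance to `centre`. -/
noncomputable def obj (x : Plane) : ℝ := ‖x - centre‖ ^ 2

lemma hasGradientAt_obj (x : Plane) : HasGradientAt obj ((2 : ℝ) • (x - centre)) x := by
  rw [hasGradientAt_iff_hasFDerivAt]
  have h1 : HasFDerivAt (fun y : Plane => y - centre) (ContinuousLinearMap.id ℝ Plane) x :=
    (hasFDerivAt_id x).sub_const centre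
  have h2 := h1.norm_sq
  refine h2.congr_fderiv ?_
  ext v
  simp

lemma gradient_obj (x : Plane) : gradient obj x = (2 : ℝ) • (x - centre) :=
  (hasGradientAt_obj x).gradient

lemma differentiable_obj : Differentiable ℝ obj := fun x =>
  (hasGradientAt_obj x).hasFDerivAt.differentiableAt

lemma isStronglyConvex_obj : IsStronglyConvex obj 1 := by
  intro x y
  have h : y - centre = (x - centre) + (y - x) := by abel
  rw [gradient_obj, obj, obj, h, norm_add_sq_real, inner_smul_left]
  simp

lemma lipschitz_obj : LipschitzOnWith 20 obj (Metric.closedBall centre 10) := by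
  refine LipschitzOnWith.of_dist_le_mul fun x hx y hy => ?_
  rw [Metric.mem_closedBall, dist_eq_norm] at hx hy
  rw [Real.dist_eq, dist_eq_norm, obj, obj]
  have h1 : |‖x - centre‖ - ‖y - centre‖| ≤ ‖x - y‖ := by
    have := abs_norm_sub_norm_le (x - centre) (y - centre)
    rwa [sub_sub_sub_cancel_right] at this
  have h2 : ‖x - centre‖ ^ 2 - ‖y - centre‖ ^ 2 =
      (‖x - centre‖ + ‖y - centre‖) * (‖x - centre‖ - ‖y - centre‖) := by ring
  rw [h2, abs_mul, abs_of_nonneg (by positivity)]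
  have h3 : ‖x - centre‖ + ‖y - centre‖ ≤ 20 := by linarith
  exact mul_le_mul h3 h1 (abs_nonneg _) (by norm_num)

lemma obj_emb (w : Lattice2) : obj (emb w) = (w 0 + 7 / 5) ^ 2 + (w 1 + 1 / 10) ^ 2 := by
  rw [obj, EuclideanSpace.norm_sq_eq]
  simp [emb, centre, Fin.sum_univ_two]
  ring

/-- The initial set. -/
def start : UniSet := ⟨0, 1, by simp⟩

lemma start_pt (i j : ℤ) : start.pt i j = ![i, j] := by
  funext t
  rw [start.pt_apply]
  fin_cases t <;> simp [start, UniSet.u1, UniSet.u2]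

lemma gA_start (i j : ℤ) : start.gA obj i j = 2 * (i + 7 / 5) := by
  have : emb start.u1 = !₂[1, 0] := by
    ext t; fin_cases t <;> simp [emb, start, UniSet.u1]
  rw [UniSet.gA, gradient_obj, this, start_pt, inner_smul_left]
  simp [emb, centre, PiLp.inner_apply, Fin.sum_univ_two]
  ring

lemma gB_start (i j : ℤ) : start.gB obj i j = 2 * (j + 1 / 10) := by
  have : emb start.u2 = !₂[0, 1] := by
    ext t; fin_cases t <;> simp [emb, start, UniSet.u2]
  rw [UniSet.gB, gradient_obj, this, start_pt, inner_smul_left]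
  simp [emb, centre, PiLp.inner_apply, Fin.sum_univ_two]
  ring

lemma activeSet_start : activeSet obj start.carrier = {start.pt 0 0} := by
  have hz : start.pt 0 0 ∈ activeSet obj start.carrier := by
    rw [active00]
    simp only [gA_start, gB_start]
    norm_num
  have hb : start.pt 1 0 ∉ activeSet obj start.carrier := by
    rw [active10]
    simp only [gA_start, gB_start]
    norm_num
  have hd : start.pt 0 1 ∉ activeSet obj start.carrier := by
    rw [active01]
    simp only [gA_start, gB_start]
    norm_num
  have he : start.pt 1 1 ∉ activeSet obj start.carrier := by
    rw [active11]
    simp only [gA_start, gB_start]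
    norm_num
  ext w
  rw [activeSet_eq_of hz, Set.mem_singleton_iff]
  tauto

lemma preprocessed_start : Preprocessed obj start := by
  have h : (activeSet obj start.carrier).ncard = 1 := by
    rw [activeSet_start]
    exact Set.ncard_singleton _
  refine ⟨?_, by omega, by omega⟩
  have hz : start.pt 0 0 ∈ activeSet obj start.carrier := by rw [activeSet_start]; simp
  rw [start.pt_zero] at hz
  exact hz.2

lemma isOptimal_iff (w : Lattice2) : IsOptimal obj w ↔ w = start.pt (-1) 0 := by
  have key : ∀ w : Lattice2, w ≠ start.pt (-1) 0 → obj (emb (start.pt (-1) 0)) < obj (emb w) := by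
    intro w hw
    obtain ⟨x, y, rfl⟩ := start.exists_pt w
    rw [obj_emb, obj_emb, start_pt, start_pt]
    simp only [Matrix.cons_val_zero, Matrix.cons_val_one]
    have hxy : x ≠ -1 ∨ y ≠ 0 := by
      by_contra hcon
      push Not at hcon
      exact hw (by rw [hcon.1, hcon.2])
    have hx : x = -1 ∨ (9 : ℝ) / 25 ≤ ((x : ℝ) + 7 / 5) ^ 2 := by
      rcases lt_trichotomy x (-1) with h | h | h
      · right
        have : (x : ℝ) ≤ -2 := by exact_mod_cast (by omega : x ≤ -2)
        nlinarith
      · exact Or.inl h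
      · right
        have : (0 : ℝ) ≤ x := by exact_mod_cast (by omega : 0 ≤ x)
        nlinarith
    have hy : y = 0 ∨ (81 : ℝ) / 100 ≤ ((y : ℝ) + 1 / 10) ^ 2 := by
      rcases lt_trichotomy y 0 with h | h | h
      · right
        have : (y : ℝ) ≤ -1 := by exact_mod_cast (by omega : y ≤ -1)
        nlinarith
      · exact Or.inl h
      · right
        have : (1 : ℝ) ≤ y := by exact_mod_cast (by omega : 1 ≤ y)
        nlinarith
    rcases hx with rfl | hx <;> rcases hy with rfl | hy
    · simp at hxy
    · push_cast; linarith
    · push_cast; linarith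
    · push_cast; linarith
  constructor
  · intro h
    by_contra hw
    exact absurd (h (start.pt (-1) 0)) (not_le.mpr (key w hw))
  · rintro rfl x
    by_cases hx : x = start.pt (-1) 0
    · rw [hx]
    · exact (key x hx).le

lemma emb_mem_closedBall {w : Lattice2} (h : obj (emb w) ≤ 100) :
    emb w ∈ Metric.closedBall centre 10 := by
  rw [Metric.mem_closedBall, dist_eq_norm]
  rw [obj] at h
  nlinarith [norm_nonneg (emb w - centre)]

lemma setting : Setting obj 20 1 (Metric.closedBall centre 10) 0 start (start.pt (-1) 0) where
  differentiable := differentiable_obj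
  c_pos := one_pos
  stronglyConvex := isStronglyConvex_obj
  carrier_eq := rfl
  preprocessed := preprocessed_start
  optimal := (isOptimal_iff _).mpr rfl
  convex := convex_closedBall _ _
  carrier_mem := by
    rw [forall_carrier]
    refine ⟨?_, ?_, ?_, ?_⟩ <;> apply emb_mem_closedBall <;> rw [obj_emb, start_pt] <;> norm_num
  optimal_mem := by
    apply emb_mem_closedBall
    rw [obj_emb, start_pt]
    norm_num
  lipschitz := lipschitz_obj

/-- A labelling of the set after the first update. -/
def next : UniSet := start.sub 0 0 (-1) 0 0 (-1) (by norm_num)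

lemma flipTo_start : ∃ V, FlipTo obj start V ∧ latticeCell start.z V = next.carrier := by
  have hA := activeSet_start
  rw [start.pt_zero] at hA
  refine ⟨_, FlipTo.case1 hA, latticeCell_eq_sub start (-1) 0 0 (-1) _ ?_ ?_⟩
  · rw [flipSign_eq_gA, gA_start, descentSign, if_neg (by norm_num)]
    module
  · rw [flipSign_eq_gB, gB_start, descentSign, if_neg (by norm_num)]
    module

lemma not_latticeFree_next : ¬ LatticeFree obj next.carrier := by
  intro h
  refine h (start.pt (-2) 0) ?_
  show ∀ v ∈ next.carrier, cutVal obj v (start.pt (-2) 0) < 0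
  rw [forall_carrier, next]
  simp only [start.sub_pt, start.cutVal_pt, gA_start, gB_start]
  norm_num

lemma start_not_containsOptimal : ¬ ContainsOptimal obj start := by
  rintro ⟨w, hw, hopt⟩
  rw [isOptimal_iff] at hopt
  rw [hopt, start.pt_mem_carrier] at hw
  omega

/-- The flip turns the square at the origin into `{-1, 0}²`, which contains the unique optimum `(-1,
0)`. The centre lies between `(-2, 0)` and `(-1, 0)` in the first coordinate, and no vertex cuts
`(-2, 0)`. -/
lemma exists_run :
    ∃ (f : Plane → ℝ) (L : NNReal) (c : ℝ) (K : Set Plane) (z₀ : Lattice2) (P₀ : UniSet)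
        (zs : Lattice2), Setting f L c K z₀ P₀ zs ∧
      ∃ s : ℕ → UniSet, IsRun f P₀ s ∧
        ∃ T : ℕ, 0 < T ∧ (T : ℝ) ≤ (6 * (L : ℝ) / c + 2) * (rDist P₀ zs : ℝ) ∧
          (∀ i < T, Update f (s i) (s (i + 1)) ∧ ¬ ContainsOptimal f (s i)) ∧
          ContainsOptimal f (s T) ∧
          ¬ LatticeFree f (s T).carrier := by
  have hf := isStronglyConvex_obj.latticeConvex one_pos
  obtain ⟨V, hV, hcV⟩ := flipTo_start
  obtain ⟨Q, hQ, hQ'⟩ := exists_preprocessed hf next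
  have hcan := canUpdate_of_not_containsOptimal hf preprocessed_start setting.optimal
    start_not_containsOptimal
  have hup : Update obj start Q := ⟨hcan, V, hV, hQ.trans hcV.symm, hQ'⟩
  obtain ⟨t, ht0, ht⟩ := exists_isRun hf Q
  refine ⟨obj, 20, 1, _, 0, start, _, setting, fun n => Nat.casesOn n start t, ⟨rfl, ?_⟩, 1,
    one_pos, ?_, ?_, ?_, ?_⟩
  · rintro (_ | i)
    · left
      show Update obj start (t 0)
      rwa [ht0]
    · exact ht i
  · have h1 : 1 ≤ rDist start (start.pt (-1) 0) := by
      obtain ⟨i, j, p, q, hmem, hpq, hr⟩ := exists_rDist_eq start (start.pt (-1) 0)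
      rw [start.pt_inj] at hpq
      rw [start.pt_mem_carrier] at hmem
      have := le_abs_self (p - i)
      have := neg_le_abs (p - i)
      have := abs_nonneg (q - j)
      omega
    have h1' : (1 : ℝ) ≤ rDist start (start.pt (-1) 0) := by exact_mod_cast h1
    push_cast
    linarith
  · intro i hi
    obtain rfl : i = 0 := by omega
    refine ⟨?_, start_not_containsOptimal⟩
    show Update obj start (t 0)
    rwa [ht0]
  · show ContainsOptimal obj (t 0)
    rw [ht0]
    refine ⟨start.pt (-1) 0, ?_, setting.optimal⟩
    rw [hQ, next, start.carrier_sub]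
    norm_num
  · show ¬ LatticeFree obj (t 0).carrier
    rw [ht0, hQ]
    exact not_latticeFree_next

end NonLatticeFree

theorem mainTheorem5 :
    (∀ (f : Plane → ℝ) (L : NNReal) (c : ℝ) (K : Set Plane) (z₀ : Lattice2) (P₀ : UniSet)
        (zs : Lattice2), Setting f L c K z₀ P₀ zs →
      (∃ s : ℕ → UniSet, IsRun f P₀ s) ∧
      ∀ s : ℕ → UniSet, IsRun f P₀ s →
        ∃ T : ℕ, (T : ℝ) ≤ (6 * (L : ℝ) / c + 2) * (rDist P₀ zs : ℝ) ∧
          (∀ i < T, Update f (s i) (s (i + 1))) ∧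
          ContainsOptimal f (s T)) ∧
    (∃ (f : Plane → ℝ) (L : NNReal) (c : ℝ) (K : Set Plane) (z₀ : Lattice2) (P₀ : UniSet)
        (zs : Lattice2), Setting f L c K z₀ P₀ zs ∧
      ∃ s : ℕ → UniSet, IsRun f P₀ s ∧
        ∃ T : ℕ, 0 < T ∧ (T : ℝ) ≤ (6 * (L : ℝ) / c + 2) * (rDist P₀ zs : ℝ) ∧
          (∀ i < T, Update f (s i) (s (i + 1)) ∧ ¬ ContainsOptimal f (s i)) ∧
          ContainsOptimal f (s T) ∧
          ¬ LatticeFree f (s T).carrier) := by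
  classical
  refine ⟨fun f L c K z₀ P₀ zs S => ?_, NonLatticeFree.exists_run⟩
  have hf := S.stronglyConvex.latticeConvex S.c_pos
  refine ⟨exists_isRun hf P₀, fun s hs => ?_⟩
  have hex : ∃ n, ContainsOptimal f (s n) := by
    by_contra hcon
    push Not at hcon
    obtain ⟨n, hn⟩ := exists_nat_gt ((6 * (L : ℝ) / c + 2) * (rDist P₀ zs : ℝ))
    have := S.bound hs n fun i _ => hcon i
    linarith
  refine ⟨Nat.find hex, ?_, fun i hi => ?_, Nat.find_spec hex⟩
  · rcases Nat.eq_zero_or_pos (Nat.find hex) with h | h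
    · rw [h]
      have := S.c_pos
      push_cast
      positivity
    · obtain ⟨n, hn⟩ : ∃ n, Nat.find hex = n + 1 := ⟨Nat.find hex - 1, by omega⟩
      have := S.bound hs n fun i hi => Nat.find_min hex (by omega)
      rw [hn]
      push_cast
      exact this
  · exact hs.update_of_not_containsOptimal hf S.preprocessed S.optimal (Nat.find_min hex hi)
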